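/- A basic sequence is a sequence of integers $\ge 2$. For a basic sequence $Q=(q_n)_{n\ge1}$, every real $x$ has a unique $Q$-Cantor series expansion $x=\lfloor x\rfloor+\sum_{n\ge1}\frac{E_n}{q_1\cdots q_n}$ with $E_n\in\{0,\dots,q_n-1\}$ and $E_n\ne q_n-1$ infinitely often. A block of length $k$ is a $k$-tuple of non-negative integers, and $N_n^Q(B,x)$ is the number of occurrences of the block $B$ in $(E_1,E_2,\dots)$ that start at a position $\le n$. Put $Q_n^{(k)}=\sum_{j=1}^n\frac1{q_jq_{j+1}\cdots q_{j+k-1}}$ and $T_{Q,n}(x)=q_1\cdots q_n\,x \bmod 1$. The sequence $Q$ is infinite in limit if $q_n\to\infty$, $k$-divergent if $Q_n^{(k)}\to\infty$, and fully divergent if it is $k$-divergent for all $k\ge1$. Let $\mathscr N_k(Q)$ be the set of real $x$ with $\lim_{n\to\infty}N_n^Q(B,x)/Q_n^{(k)}=1$ for every block $B$ of length $k$, let $\mathscr N(Q)=\bigcap_{k\ge1}\mathscr N_k(Q)$, and let $\mathscr{DN}(Q)$ be the set of real $x$ such that $(T_{Q,n}(x))_{n\ge0}$ is uniformly distributed modulo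 $1$. **Theorem.** Let $\alpha=(\alpha_i)$ and $\beta=(\beta_i)$ be basic sequences, let $s=(s_i)$, $t=(t_i)$, $\upsilon=(\upsilon_i)$ be sequences of non-negative integers, and let $Q=Q(\alpha,\beta,s,t,\upsilon)$ be the concatenation $$\big[[\alpha_1]^{s_1}[\beta_1]^{t_1}\big]^{\upsilon_1}\big[[\alpha_2]^{s_2}[\beta_2]^{t_2}\big]^{\upsilon_2}\big[[\alpha_3]^{s_3}[\beta_3]^{t_3}\big]^{\upsilon_3}\cdots,$$ where $[w]^m$ is $w$ repeated $m$ times. Let $k\ge1$ be an integer. Suppose that $Q$ is infinite in limit, that $\alpha_i=o(\beta_i)$, and that the following hold (each including that the denominator is nonzero for all large $n$): * (HDT1) $\displaystyle\lim_{n\to\infty}\frac{s_n\log\alpha_n}{\sum_{i=1}^{n-1}\upsilon_it_i\log\beta_i}=0$; * (HDT2) $\displaystyle\lim_{n\to\infty}\frac{s_n\log\alpha_n}{t_n\log\beta_n}=0$; * (NQ) $\displaystyle\lim_{n\to\infty}\frac{t_n\alpha_n^j}{s_n\beta_n^j}=0$ for all integers $j\ge1$; * (RNQ) $\displaystyle\lim_{n\to\infty}\frac{\alpha_n^k}{s_n}=0$;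 * (DNQ) $\displaystyle\lim_{n\to\infty}\frac{\sum_{i=1}^n\upsilon_is_i}{\sum_{i=1}^n\upsilon_i(s_i+t_i)}=0$. If $Q$ is $k$-divergent, then $$\dim_H\Big(\bigcap_{j=1}^k\mathscr N_j(Q)\setminus\mathscr{DN}(Q)\Big)=1.$$ If $Q$ is fully divergent, then $$\dim_H\big(\mathscr N(Q)\setminus\mathscr{DN}(Q)\big)=1.$$ -/

import Mathlib

open Filter Topology Asymptotics

noncomputable section

/-! Sequences are indexed from `0`: the value at `n : ℕ` is the term that is written with
index `n + 1` when sequences start at `1`. -/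

/-- A basic sequence: every term is an integer `≥ 2`. -/
def IsBasicSequence (Q : ℕ → ℕ) : Prop := ∀ n, 2 ≤ Q n

/-- `q_n → ∞`. -/
def InfiniteInLimit (Q : ℕ → ℕ) : Prop := Tendsto Q atTop atTop

/-- `Q_n^{(k)} = ∑_{j=1}^n 1 / (q_j q_{j+1} ⋯ q_{j+k-1})`. -/
def blockMean (Q : ℕ → ℕ) (k n : ℕ) : ℝ :=
  ∑ j ∈ Finset.range n, 1 / ∏ l ∈ Finset.range k, (Q (j + l) : ℝ)

/-- `Q` is `k`-divergent. -/
def KDivergent (Q : ℕ → ℕ) (k : ℕ) : Prop := Tendsto (blockMean Q k) atTop atTop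

/-- `Q` is fully divergent. -/
def FullyDivergent (Q : ℕ → ℕ) : Prop := ∀ k, 1 ≤ k → KDivergent Q k

/-- `T_{Q,n}(x) = (q_1 ⋯ q_n) x mod 1`. -/
def shiftMap (Q : ℕ → ℕ) (n : ℕ) (x : ℝ) : ℝ :=
  Int.fract ((∏ j ∈ Finset.range n, (Q j : ℝ)) * x)

/-- `E` is the sequence of digits after the point of the `Q`-Cantor series expansion of `x`. -/
def IsCantorExpansion (Q : ℕ → ℕ) (x : ℝ) (E : ℕ → ℕ) : Prop :=
  (∀ n, E n < Q n) ∧ (∃ᶠ n in atTop, E n ≠ Q n - 1) ∧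
    HasSum (fun n => (E n : ℝ) / ∏ j ∈ Finset.range (n + 1), (Q j : ℝ)) (x - ⌊x⌋)

/-- The digits of the `Q`-Cantor series expansion of `x`, computed by the greedy algorithm. They
form the one and only expansion in the sense of `IsCantorExpansion`; see
`isCantorExpansion_iff`. -/
def cantorDigit (Q : ℕ → ℕ) (x : ℝ) (n : ℕ) : ℕ := ⌊(Q n : ℝ) * shiftMap Q n x⌋₊

/-- `N_n^Q(B, x)`: the number of occurrences of the block `B`, with starting position among the
first `n` positions, in the digits of the `Q`-Cantor series expansion of `x`. -/
def blockCount (Q : ℕ → ℕ) {k : ℕ} (B : Fin k → ℕ) (x : ℝ) (n : ℕ) : ℕ :=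
  Nat.card {p : ℕ // p < n ∧ ∀ l : Fin k, cantorDigit Q x (p + l) = B l}

/-- The set of real numbers that are `Q`-normal of order `k`. -/
def normalOfOrder (Q : ℕ → ℕ) (k : ℕ) : Set ℝ :=
  {x | ∀ B : Fin k → ℕ,
    Tendsto (fun n => (blockCount Q B x n : ℝ) / blockMean Q k n) atTop (𝓝 1)}

/-- The set of `Q`-normal real numbers. -/
def normalNumbers (Q : ℕ → ℕ) : Set ℝ := ⋂ k ∈ Set.Ici 1, normalOfOrder Q k

/-- A real sequence is uniformly distributed modulo one. -/
def UniformlyDistributedModOne (u : ℕ → ℝ) : Prop :=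
  ∀ a b : ℝ, 0 ≤ a → a < b → b ≤ 1 →
    Tendsto (fun N : ℕ => (Nat.card {n : ℕ // n < N ∧ Int.fract (u n) ∈ Set.Ico a b} : ℝ) / N)
      atTop (𝓝 (b - a))

/-- The set of `Q`-distribution normal real numbers. -/
def distributionNormal (Q : ℕ → ℕ) : Set ℝ :=
  {x | UniformlyDistributedModOne (fun n => shiftMap Q n x)}

/-- The number `∑_{j<i} υ_j (s_j + t_j)` of terms in the stages before stage `i`. -/
def stageStart (s t υ : ℕ → ℕ) (i : ℕ) : ℕ := ∑ j ∈ Finset.range i, υ j * (s j + t j)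

/-- The stage to which position `n` belongs. -/
def stageOf (s t υ : ℕ → ℕ) (n : ℕ) : ℕ := sInf {i | n < stageStart s t υ (i + 1)}

/-- The sequence `Q(α, β, s, t, υ)`, that is, the concatenation
`[[α_1]^{s_1} [β_1]^{t_1}]^{υ_1} [[α_2]^{s_2} [β_2]^{t_2}]^{υ_2} ⋯`; see `blockSeq_apply`.
If that concatenation is a finite word, the value is a bounded sequence, so that it is not infinite
in limit. -/
def blockSeq (α β s t υ : ℕ → ℕ) (n : ℕ) : ℕ :=
  let i := stageOf s t υ n
  if (n - stageStart s t υ i) % (s i + t i) < s i then α i else β i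

/-- `lim a_n / b_n = 0`, where the quotients are meaningful for all large `n`. -/
def QuotientTendstoZero (a b : ℕ → ℝ) : Prop :=
  (∀ᶠ n in atTop, b n ≠ 0) ∧ Tendsto (fun n => a n / b n) atTop (𝓝 0)

/-- `lim s_n log α_n / ∑_{i=1}^{n-1} υ_i t_i log β_i = 0`. -/
def CondHDT1 (α β s t υ : ℕ → ℕ) : Prop :=
  QuotientTendstoZero (fun n => (s n : ℝ) * Real.log (α n))
    (fun n => ∑ i ∈ Finset.range n, (υ i : ℝ) * (t i : ℝ) * Real.log (β i))

/-- `lim s_n log α_n / (t_n log β_n) = 0`. -/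
def CondHDT2 (α β s t : ℕ → ℕ) : Prop :=
  QuotientTendstoZero (fun n => (s n : ℝ) * Real.log (α n))
    (fun n => (t n : ℝ) * Real.log (β n))

/-- `lim t_n α_n^k / (s_n β_n^k) = 0`. -/
def CondNQ (α β s t : ℕ → ℕ) (k : ℕ) : Prop :=
  QuotientTendstoZero (fun n => (t n : ℝ) * (α n : ℝ) ^ k) (fun n => (s n : ℝ) * (β n : ℝ) ^ k)

/-- `lim α_n^k / s_n = 0`. -/
def CondRNQ (α s : ℕ → ℕ) (k : ℕ) : Prop :=
  QuotientTendstoZero (fun n => (α n : ℝ) ^ k) (fun n => (s n : ℝ))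

/-- `lim ∑_{i=1}^n υ_i s_i / ∑_{i=1}^n υ_i (s_i + t_i) = 0`. -/
def CondDNQ (s t υ : ℕ → ℕ) : Prop :=
  QuotientTendstoZero (fun n => ∑ i ∈ Finset.range (n + 1), (υ i : ℝ) * (s i : ℝ))
    (fun n => ∑ i ∈ Finset.range (n + 1), (υ i : ℝ) * ((s i : ℝ) + (t i : ℝ)))

/-! The two facts below confirm that `blockSeq` and `cantorDigit` are what their names say. -/

theorem blockSeq_apply (α β s t υ : ℕ → ℕ) {i c d : ℕ} (hc : c < υ i) (hd : d < s i + t i) :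
    blockSeq α β s t υ (stageStart s t υ i + c * (s i + t i) + d) =
      if d < s i then α i else β i := by
  have hmono : Monotone (stageStart s t υ) := by
    refine monotone_nat_of_le_succ fun n => ?_
    simp [stageStart, Finset.sum_range_succ]
  have hsucc : stageStart s t υ (i + 1) = stageStart s t υ i + υ i * (s i + t i) := by
    simp [stageStart, Finset.sum_range_succ]
  have hmul : (c + 1) * (s i + t i) ≤ υ i * (s i + t i) := Nat.mul_le_mul_right _ hc
  have hst : stageOf s t υ (stageStart s t υ i + c * (s i + t i) + d) = i := by
    have hmem : i ∈ {j | stageStart s t υ i + c * (s i + t i) + d < stageStart s t υ (j + 1)} := by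
      rw [Set.mem_ofPred_eq, hsucc]; linarith
    refine le_antisymm (Nat.sInf_le hmem) ?_
    by_contra! hlt
    have h1 := Nat.sInf_mem (Set.nonempty_of_mem hmem)
    have h2 : stageStart s t υ (stageOf s t υ (stageStart s t υ i + c * (s i + t i) + d) + 1) ≤
      stageStart s t υ i := hmono hlt
    have h3 : stageStart s t υ i + c * (s i + t i) + d <
      stageStart s t υ (stageOf s t υ (stageStart s t υ i + c * (s i + t i) + d) + 1) := h1
    omega
  have hr : (stageStart s t υ i + c * (s i + t i) + d - stageStart s t υ i) % (s i + t i) = d := by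
    rw [add_assoc, Nat.add_sub_cancel_left, mul_comm c, Nat.mul_add_mod, Nat.mod_eq_of_lt hd]
  simp only [blockSeq, hst, hr]

theorem isCantorExpansion_iff {Q : ℕ → ℕ} (hQ : IsBasicSequence Q) (x : ℝ) (E : ℕ → ℕ) :
    IsCantorExpansion Q x E ↔ E = cantorDigit Q x := by
  set P : ℕ → ℝ := fun n => ∏ j ∈ Finset.range n, (Q j : ℝ) with hP
  have hq : ∀ n, (2 : ℝ) ≤ Q n := fun n => by exact_mod_cast hQ n
  have hP0 : P 0 = 1 := by simp [hP]
  have hPs : ∀ n, P (n + 1) = P n * Q n := fun n => by simp [hP, Finset.prod_range_succ]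
  have hPpow : ∀ n, (2 : ℝ) ^ n ≤ P n := by
    intro n
    induction n with
    | zero => simp [hP0]
    | succ n ih =>
      rw [hPs, pow_succ]
      exact mul_le_mul ih (hq n) (by norm_num) (le_trans (by positivity) ih)
  have hPpos : ∀ n, 0 < P n := fun n => lt_of_lt_of_le (by positivity) (hPpow n)
  have hPinv : Tendsto (fun n => 1 / P n) atTop (𝓝 0) := by
    have h2 : Tendsto (fun n : ℕ => (2 : ℝ) ^ n) atTop atTop :=
      tendsto_pow_atTop_atTop_of_one_lt (by norm_num)
    simp only [one_div]
    exact (tendsto_atTop_mono hPpow h2).inv_tendsto_atTop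
  set f : ℕ → ℝ := fun n => shiftMap Q n x with hf
  have hf0 : ∀ n, 0 ≤ f n := fun n => Int.fract_nonneg _
  have hf1 : ∀ n, f n < 1 := fun n => Int.fract_lt_one _
  have hfP : ∀ n, f n = Int.fract (P n * x) := fun n => rfl
  have hdle : ∀ n, (cantorDigit Q x n : ℝ) ≤ Q n * f n := fun n =>
    Nat.floor_le (mul_nonneg (by positivity) (hf0 n))
  have hdlt : ∀ n, (Q n : ℝ) * f n < cantorDigit Q x n + 1 := fun n => Nat.lt_floor_add_one _
  have hfs : ∀ n, f (n + 1) = Q n * f n - cantorDigit Q x n := by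
    intro n
    rw [hfP, Int.fract_eq_iff]
    refine ⟨by linarith [hdle n], by linarith [hdlt n],
      Q n * ⌊P n * x⌋ + cantorDigit Q x n, ?_⟩
    have : f n = P n * x - ⌊P n * x⌋ := rfl
    rw [this, hPs]
    push_cast
    ring
  constructor
  · rintro ⟨hlt, hfreq, hsum⟩
    have hle : ∀ n, (E n : ℝ) ≤ Q n - 1 := fun n => by
      have : (E n : ℝ) + 1 ≤ Q n := by exact_mod_cast hlt n
      linarith
    -- the rescaled tail of the expansion lies in `[0, 1)` and differs from `P n * x` by an integer
    have key : ∀ n, f n = P n * (x - ⌊x⌋ - ∑ m ∈ Finset.range n, (E m : ℝ) / P (m + 1)) := by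
      intro n
      have htail : HasSum (fun m => (E (m + n) : ℝ) / P (m + n + 1))
          (x - ⌊x⌋ - ∑ m ∈ Finset.range n, (E m : ℝ) / P (m + 1)) :=
        (hasSum_nat_add_iff' n).2 hsum
      have hnn : ∀ m, 0 ≤ (E (m + n) : ℝ) / P (m + n + 1) := fun m =>
        div_nonneg (by positivity) (hPpos _).le
      have hgeom : HasSum (fun m => 1 / P (m + n) - 1 / P (m + n + 1)) (1 / P n) := by
        have hstep : ∀ m, 1 / P (m + n) - 1 / P (m + n + 1) =
            ((Q (m + n) : ℝ) - 1) / P (m + n + 1) := by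
          intro m
          have h1 := (hPpos (m + n)).ne'
          have h2 : (Q (m + n) : ℝ) ≠ 0 := by linarith [hq (m + n)]
          rw [hPs]
          field_simp
        rw [hasSum_iff_tendsto_nat_of_nonneg]
        · have hs : ∀ N, ∑ m ∈ Finset.range N, (1 / P (m + n) - 1 / P (m + n + 1)) =
              1 / P n - 1 / P (N + n) := by
            intro N
            have := Finset.sum_range_sub' (fun m => 1 / P (m + n)) N
            simpa [add_right_comm] using this
          simp only [hs]
          simpa using tendsto_const_nhds.sub ((tendsto_add_atTop_iff_nat n).2 hPinv)
        · intro m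
          rw [hstep]
          exact div_nonneg (by linarith [hq (m + n)]) (hPpos _).le
      have hcmp : ∀ m, (E (m + n) : ℝ) / P (m + n + 1) ≤ 1 / P (m + n) - 1 / P (m + n + 1) := by
        intro m
        have h1 := (hPpos (m + n)).ne'
        have h2 : (Q (m + n) : ℝ) ≠ 0 := by linarith [hq (m + n)]
        have : 1 / P (m + n) - 1 / P (m + n + 1) = ((Q (m + n) : ℝ) - 1) / P (m + n + 1) := by
          rw [hPs]; field_simp
        rw [this]
        exact div_le_div_of_nonneg_right (hle _) (hPpos _).le
      obtain ⟨m, hm, hne⟩ := (frequently_atTop.1 hfreq) n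
      have hstrict : (E (m - n + n) : ℝ) / P (m - n + n + 1) <
          1 / P (m - n + n) - 1 / P (m - n + n + 1) := by
        rw [Nat.sub_add_cancel hm]
        have h1 := (hPpos m).ne'
        have h2 : (Q m : ℝ) ≠ 0 := by linarith [hq m]
        have h3 : 1 / P m - 1 / P (m + 1) = ((Q m : ℝ) - 1) / P (m + 1) := by
          rw [hPs]; field_simp
        rw [h3]
        refine div_lt_div_of_pos_right ?_ (hPpos _)
        have h4 : E m + 1 < Q m := by have := hlt m; omega
        have : (E m : ℝ) + 1 < Q m := by exact_mod_cast h4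
        linarith
      have hltt := hasSum_lt hcmp hstrict htail hgeom
      have hnn' := htail.nonneg hnn
      rw [hfP, Int.fract_eq_iff]
      refine ⟨mul_nonneg (hPpos n).le hnn', ?_, ?_⟩
      · have := mul_lt_mul_of_pos_left hltt (hPpos n)
        rwa [mul_one_div_cancel (hPpos n).ne'] at this
      · have hint : ∀ N, ∃ z : ℤ, P N * ∑ m ∈ Finset.range N, (E m : ℝ) / P (m + 1) = z := by
          intro N
          induction N with
          | zero => exact ⟨0, by simp⟩
          | succ N ih =>
            obtain ⟨z, hz⟩ := ih
            refine ⟨Q N * z + E N, ?_⟩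
            rw [Finset.sum_range_succ, mul_add, mul_div_cancel₀ _ (hPpos _).ne', hPs,
              mul_comm (P N), mul_assoc, hz]
            push_cast
            ring
        obtain ⟨z, hz⟩ := hint n
        refine ⟨(∏ j ∈ Finset.range n, (Q j : ℤ)) * ⌊x⌋ + z, ?_⟩
        have hPz : ((∏ j ∈ Finset.range n, (Q j : ℤ) : ℤ) : ℝ) = P n := by simp [hP]
        rw [Int.cast_add, Int.cast_mul, hPz, ← hz]
        ring
    funext n
    have h := key (n + 1)
    rw [Finset.sum_range_succ, ← sub_sub, mul_sub, mul_div_cancel₀ _ (hPpos _).ne', hPs,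
      mul_comm (P n), mul_assoc, ← key n] at h
    symm
    refine (Nat.floor_eq_iff (mul_nonneg (by positivity) (hf0 n))).2 ⟨?_, ?_⟩
    · have := hf0 (n + 1)
      show (E n : ℝ) ≤ Q n * f n
      linarith
    · have := hf1 (n + 1)
      show (Q n : ℝ) * f n < E n + 1
      linarith
  · rintro rfl
    refine ⟨fun n => ?_, ?_, ?_⟩
    · have h1 : (Q n : ℝ) * f n < Q n := by nlinarith [hq n, hf1 n]
      exact_mod_cast (hdle n).trans_lt h1
    · rw [frequently_atTop]
      by_contra! hcon
      obtain ⟨N, hN⟩ := hcon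
      have hgrow : ∀ m, (2 : ℝ) ^ m * (1 - f N) ≤ 1 - f (N + m) := by
        intro m
        induction m with
        | zero => simp
        | succ m ih =>
          have hd : (cantorDigit Q x (N + m) : ℝ) = Q (N + m) - 1 := by
            rw [hN (N + m) (by omega), Nat.cast_sub (by linarith [hQ (N + m)])]
            simp
          have h := hfs (N + m)
          rw [hd] at h
          rw [← add_assoc, h, pow_succ]
          nlinarith [hq (N + m), hf1 (N + m)]
      have hpos : 0 < 1 - f N := by linarith [hf1 N]
      obtain ⟨m, hm⟩ := pow_unbounded_of_one_lt (1 / (1 - f N)) (one_lt_two : (1 : ℝ) < 2)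
      rw [div_lt_iff₀ hpos] at hm
      linarith [hgrow m, hf0 (N + m)]
    · rw [hasSum_iff_tendsto_nat_of_nonneg]
      · have hs : ∀ N, ∑ m ∈ Finset.range N, (cantorDigit Q x m : ℝ) / P (m + 1) =
            x - ⌊x⌋ - f N / P N := by
          intro N
          induction N with
          | zero => simp [hfP, hP0]
          | succ N ih =>
            have h1 := (hPpos N).ne'
            have h2 : (Q N : ℝ) ≠ 0 := by linarith [hq N]
            rw [Finset.sum_range_succ, ih, hfs, hPs]
            field_simp
            ring
        have hz : Tendsto (fun N => f N / P N) atTop (𝓝 0) :=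
          squeeze_zero (fun N => div_nonneg (hf0 N) (hPpos N).le)
            (fun N => div_le_div_of_nonneg_right (hf1 N).le (hPpos N).le) hPinv
        have := (tendsto_const_nhds (x := x - ⌊x⌋)).sub hz
        rw [sub_zero] at this
        exact this.congr fun N => (hs N).symm
      · intro m
        exact div_nonneg (by positivity) (hPpos _).le

end

/-! Let `A` be the set of positions whose base comes from `α`. These positions decide block
frequencies but are invisible to distribution and to dimension. By DNQ, `A` has arbitrarily small
relative frequency along a sequence of times. By HDT1 and HDT2, the sum of `log q` over `A` is
negligible against the sum over the complement. By NQ, together with `s → ∞` (which RNQ yields), the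
blocks that leave `A` contribute a negligible part of the expected number of occurrences.

Hence fix the digits on `A` to be one typical random sequence `ω`, and off `A` let the digits range
over `[b, 2b)`, where `b` is about `q / 4`. Digits off `A` tend to infinity, so from some position
on a given block occurs only inside `A`, where `ω` has the right frequencies: the number is normal.
Digits off `A` are eventually below `q / 2`, so the orbit almost never visits `[3/4, 1)` along the
sparse times: the number is not distribution normal.

For the dimension, let `c` count the admissible digits: `c = 1` on `A` and `c ≥ q / 8` off `A`.
Since `A` carries little entropy, `∏ c` exceeds every power `(∏ q) ^ r` with `r < 1` up to a
constant. Transporting `c`-digits to `Q`-digits maps `[0, 1)` injectively into the constructed set,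
with an inverse that is Hölder of exponent `r`; so the dimension is at least `r`.

The existence of `ω` is `exists_digits_with_expected_frequencies`, the dimension bound
`one_le_dimH_digits`, and the combination `dimH_normal_diff_distributionNormal`. Its entropy and
frequency hypotheses are checked in `exists_sum_log_le` and `exists_sum_nearCompl_le`. -/

open MeasureTheory ProbabilityTheory

/-! ### A law of large numbers for events with finite-range dependence -/

/-- If the ratio of two increasing sequences, the second one with steps at most `1`, tends to `1`
along the times at which the second one reaches the squares, then the ratio tends to `1`. -/
theorem tendsto_div_one_of_squares {S M : ℕ → ℝ} (hS : Monotone S) (hS0 : ∀ n, 0 ≤ S n)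
    (hM : Monotone M) (N : ℕ → ℕ) (hN1 : ∀ i : ℕ, (i : ℝ) ^ 2 ≤ M (N i))
    (hN2 : ∀ i : ℕ, M (N i) ≤ (i : ℝ) ^ 2 + 1) (hNmin : ∀ (i : ℕ) n, (i : ℝ) ^ 2 ≤ M n → N i ≤ n)
    (hMtop : Tendsto M atTop atTop)
    (h : Tendsto (fun i => S (N i) / M (N i)) atTop (𝓝 1)) :
    Tendsto (fun n => S n / M n) atTop (𝓝 1) := by
  -- For `i = ⌊√(M n)⌋` one has `i² ≤ M n < (i + 1)²`, hence `N i ≤ n ≤ N (i + 1)`. Monotonicity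
  -- squeezes `S n / M n` between the ratios at these two times, up to factors tending to `1`.
  have hI : Tendsto (fun n => ⌊√(M n)⌋₊) atTop atTop :=
    tendsto_nat_floor_atTop.comp (Real.tendsto_sqrt_atTop.comp hMtop)
  have hinv : Tendsto (fun i : ℕ => (1 : ℝ) / (i : ℝ)) atTop (𝓝 0) :=
    tendsto_const_div_atTop_nhds_zero_nat 1
  have hlow : Tendsto (fun i : ℕ => S (N i) / M (N i) * ((1 + 1 / (i : ℝ)) ^ 2)⁻¹) atTop (𝓝 1) := by
    simpa using h.mul (((hinv.const_add 1).pow 2).inv₀ (by norm_num))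
  have hup : Tendsto (fun i : ℕ => S (N (i + 1)) / M (N (i + 1)) *
      ((1 + 1 / (i : ℝ)) ^ 2 + (1 / (i : ℝ)) ^ 2)) atTop (𝓝 1) := by
    simpa using (h.comp (tendsto_add_atTop_nat 1)).mul
      (((hinv.const_add 1).pow 2).add (hinv.pow 2))
  refine tendsto_of_tendsto_of_tendsto_of_le_of_le' (hlow.comp hI) (hup.comp hI) ?_ ?_
  all_goals
    filter_upwards [hI.eventually_ge_atTop 1] with n hn
    simp only [Function.comp]
    set i := ⌊√(M n)⌋₊ with hi
    have hi1 : (1 : ℝ) ≤ i := by exact_mod_cast hn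
    have hle : (i : ℝ) ≤ √(M n) := Nat.floor_le (Real.sqrt_nonneg _)
    have hMn : 0 < M n := Real.sqrt_pos.1 (by linarith)
    have hsq : (i : ℝ) ^ 2 ≤ M n := by
      rw [← Real.sq_sqrt hMn.le]; gcongr
    have hlt : M n < ((i : ℝ) + 1) ^ 2 := by
      rw [← Real.sq_sqrt hMn.le]; gcongr; exact Nat.lt_floor_add_one _
  · have hSle : S (N i) ≤ S n := hS (hNmin _ _ hsq)
    have hMi : 0 < M (N i) := lt_of_lt_of_le (by positivity) (hN1 i)
    have : S (N i) / M (N i) * ((1 + 1 / (i : ℝ)) ^ 2)⁻¹ ≤ S (N i) / (i + 1) ^ 2 := by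
      have e : S (N i) / ((i : ℝ) + 1) ^ 2 = S (N i) / (i : ℝ) ^ 2 * ((1 + 1 / (i : ℝ)) ^ 2)⁻¹ := by
        field_simp
      rw [e]
      gcongr
      · exact hS0 _
      · exact hN1 i
    refine this.trans ?_
    gcongr
    · exact hS0 _
  · have hnN : n ≤ N (i + 1) := by
      by_contra! hc
      have := hM hc.le
      have h2 := hN1 (i + 1)
      push_cast at h2
      linarith
    have hSle := hS hnN
    have hMi : 0 < M (N (i + 1)) := lt_of_lt_of_le (by positivity) (hN1 (i + 1))
    have h2 := hN2 (i + 1)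
    push_cast at h2
    have e : (1 + 1 / (i : ℝ)) ^ 2 + (1 / (i : ℝ)) ^ 2 = (((i : ℝ) + 1) ^ 2 + 1) / (i : ℝ) ^ 2 := by
      field_simp
    rw [e, div_mul_div_comm, div_le_div_iff₀ hMn (by positivity)]
    calc S n * (M (N (i + 1)) * (i : ℝ) ^ 2)
        ≤ S (N (i + 1)) * ((((i : ℝ) + 1) ^ 2 + 1) * M n) := by
          gcongr
          exact hS0 _
      _ = _ := by ring

/-- Variance of the number of occurrences among events that are independent at distance `≥ k`. -/
theorem variance_count_le {Ω : Type*} [MeasurableSpace Ω] (μ : Measure Ω) [IsProbabilityMeasure μ]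
    (k : ℕ) (D : ℕ → Set Ω) (hD : ∀ p, MeasurableSet (D p))
    (hind : ∀ p p', p + k ≤ p' → μ (D p ∩ D p') = μ (D p) * μ (D p')) (n : ℕ) :
    Var[∑ p ∈ Finset.range n, (D p).indicator (fun _ => (1 : ℝ)); μ] ≤
      (2 * k) * ∑ p ∈ Finset.range n, μ.real (D p) := by
  have hL : ∀ p, MemLp ((D p).indicator (fun _ => (1 : ℝ))) 2 μ := fun p =>
    memLp_indicator_const 2 (hD p) 1 (Or.inr (measure_ne_top _ _))
  rw [variance_sum' fun p _ => hL p, Finset.mul_sum]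
  have hcov : ∀ p p', cov[(D p).indicator (fun _ => (1 : ℝ)), (D p').indicator (fun _ => (1 : ℝ)); μ]
      = μ.real (D p ∩ D p') - μ.real (D p) * μ.real (D p') := by
    intro p p'
    have hi : ∀ s, MeasurableSet s → ∫ x, s.indicator (fun _ => (1 : ℝ)) x ∂μ = μ.real s := by
      intro s hs
      rw [integral_indicator_const _ hs]; simp
    rw [covariance_eq_sub (hL p) (hL p'), hi _ (hD p), hi _ (hD p'), ← hi _ ((hD p).inter (hD p'))]
    congr 2
    ext x
    by_cases h1 : x ∈ D p <;> by_cases h2 : x ∈ D p' <;> simp [h1, h2]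
  refine Finset.sum_le_sum fun p _ => ?_
  have hfar : ∀ p', ¬ (p' < p + k ∧ p < p' + k) →
      cov[(D p).indicator (fun _ => (1 : ℝ)), (D p').indicator (fun _ => (1 : ℝ)); μ] = 0 := by
    intro p' hp'
    rw [hcov]
    rcases le_or_gt (p + k) p' with h | h
    · rw [Measure.real, hind _ _ h, ENNReal.toReal_mul]; simp [Measure.real]
    · have h' : p' + k ≤ p := by by_contra! hc; exact hp' ⟨h, hc⟩
      rw [Set.inter_comm, Measure.real, hind _ _ h', ENNReal.toReal_mul]
      simp [Measure.real, mul_comm]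
  -- At most `2k` indices `p'` are close enough to `p` to be correlated with it, and each such
  -- covariance is at most the probability of `D p`.
  calc ∑ p' ∈ Finset.range n,
        cov[(D p).indicator (fun _ => (1 : ℝ)), (D p').indicator (fun _ => (1 : ℝ)); μ]
      ≤ ∑ p' ∈ Finset.range n, if p' < p + k ∧ p < p' + k then μ.real (D p) else 0 := by
        refine Finset.sum_le_sum fun p' _ => ?_
        split_ifs with h
        · rw [hcov]
          have := measureReal_mono (μ := μ) (Set.inter_subset_left : D p ∩ D p' ⊆ D p)
          have h2 : 0 ≤ μ.real (D p) * μ.real (D p') := by positivity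
          linarith
        · exact (hfar p' h).le
    _ = ((Finset.range n).filter fun p' => p' < p + k ∧ p < p' + k).card * μ.real (D p) := by
        rw [← Finset.sum_filter, Finset.sum_const, nsmul_eq_mul]
    _ ≤ 2 * k * μ.real (D p) := by
        gcongr
        have : ((Finset.range n).filter fun p' => p' < p + k ∧ p < p' + k) ⊆
            Finset.Ico (p + 1 - k) (p + k) := by
          intro x hx
          simp only [Finset.mem_filter, Finset.mem_range, Finset.mem_Ico] at hx ⊢
          omega
        have := Finset.card_le_card this
        rw [Nat.card_Ico] at this
        exact_mod_cast this.trans (by omega)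

/-- A strong law of large numbers for events that are independent at distance `≥ k`. -/
theorem ae_tendsto_count_div {Ω : Type*} [MeasurableSpace Ω] (μ : Measure Ω)
    [IsProbabilityMeasure μ] (k : ℕ) (D : ℕ → Set Ω) (hD : ∀ p, MeasurableSet (D p))
    (hind : ∀ p p', p + k ≤ p' → μ (D p ∩ D p') = μ (D p) * μ (D p'))
    (htop : Tendsto (fun n => ∑ p ∈ Finset.range n, μ.real (D p)) atTop atTop) :
    ∀ᵐ ω ∂μ, Tendsto (fun n => (∑ p ∈ Finset.range n, (D p).indicator (fun _ => (1 : ℝ)) ω) /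
      ∑ p ∈ Finset.range n, μ.real (D p)) atTop (𝓝 1) := by
  classical
  set M : ℕ → ℝ := fun n => ∑ p ∈ Finset.range n, μ.real (D p) with hM
  set S : ℕ → Ω → ℝ := fun n => ∑ p ∈ Finset.range n, (D p).indicator (fun _ => (1 : ℝ)) with hS
  have hMmono : Monotone M := monotone_nat_of_le_succ fun n => by
    simp only [hM, Finset.sum_range_succ]
    linarith [measureReal_nonneg (μ := μ) (s := D n)]
  have hex : ∀ i : ℕ, ∃ n, (i : ℝ) ^ 2 ≤ M n := fun i => (htop.eventually_ge_atTop _).exists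
  set N : ℕ → ℕ := fun i => Nat.find (hex i) with hN
  have hN1 : ∀ i : ℕ, (i : ℝ) ^ 2 ≤ M (N i) := fun i => Nat.find_spec (hex i)
  have hNmin : ∀ (i : ℕ) n, (i : ℝ) ^ 2 ≤ M n → N i ≤ n := fun i n h => Nat.find_min' (hex i) h
  have hN2 : ∀ i : ℕ, M (N i) ≤ (i : ℝ) ^ 2 + 1 := by
    intro i
    rcases Nat.eq_zero_or_pos (N i) with h | h
    · rw [h]
      simp only [hM, Finset.range_zero, Finset.sum_empty]
      positivity
    · obtain ⟨m, hm⟩ : ∃ m, N i = m + 1 := ⟨N i - 1, by omega⟩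
      have h1 : M m < (i : ℝ) ^ 2 := by
        by_contra! hc
        have := hNmin i m hc
        omega
      have h2 : μ.real (D m) ≤ 1 := measureReal_le_one
      rw [hm]
      simp only [hM, Finset.sum_range_succ] at h1 ⊢
      linarith
  have hL : ∀ n, MemLp (S n) 2 μ := fun n => memLp_finsetSum' _ fun p _ =>
    memLp_indicator_const 2 (hD p) 1 (Or.inr (measure_ne_top _ _))
  have hES : ∀ n, ∫ ω, S n ω ∂μ = M n := by
    intro n
    simp only [hS, hM, Finset.sum_apply]
    rw [integral_finsetSum]
    · refine Finset.sum_congr rfl fun p _ => ?_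
      rw [integral_indicator_const _ (hD p)]; simp
    · intro p _
      exact (integrable_const _).indicator (hD p)
  have hSe : ∀ n ω, S n ω = ∑ p ∈ Finset.range n, (D p).indicator (fun _ => (1 : ℝ)) ω :=
    fun n ω => by simp [hS]
  have hmeas : ∀ n, Measurable (S n) := fun n => by
    rw [funext (hSe n)]
    exact Finset.measurable_fun_sum _ fun p _ => measurable_const.indicator (hD p)
  -- Along the times `N i` the second moment of `S / M - 1` is at most `2k / M ≤ 2k / i²`. This is
  -- summable, so the squares are almost surely summable and tend to `0`.
  have hint : ∀ i : ℕ, 1 ≤ i → ∫⁻ ω, ENNReal.ofReal ((S (N i) ω / M (N i) - 1) ^ 2) ∂μ ≤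
      ENNReal.ofReal (2 * k * (1 / (i : ℝ) ^ 2)) := by
    intro i hi
    have hi' : (1 : ℝ) ≤ i := by exact_mod_cast hi
    have hMi : 0 < M (N i) := lt_of_lt_of_le (by positivity) (hN1 i)
    have e : ∀ ω, (S (N i) ω / M (N i) - 1) ^ 2 = (S (N i) ω - M (N i)) ^ 2 * (M (N i) ^ 2)⁻¹ := by
      intro ω; field_simp
    simp only [e]
    rw [← ofReal_integral_eq_lintegral_ofReal]
    · refine ENNReal.ofReal_le_ofReal ?_
      rw [integral_mul_const]
      have hv := variance_eq_integral (μ := μ) (hmeas (N i)).aemeasurable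
      rw [hES] at hv
      rw [← hv]
      have hvar := variance_count_le μ k D hD hind (N i)
      calc _ ≤ (2 * k) * M (N i) * (M (N i) ^ 2)⁻¹ := by gcongr
        _ = 2 * k * (1 / M (N i)) := by field_simp
        _ ≤ _ := by gcongr; exact hN1 i
    · exact (((hL (N i)).sub (memLp_const (M (N i)))).integrable_sq).mul_const _
    · exact Eventually.of_forall fun ω => by positivity
  have hsum : ∑' i : ℕ, ∫⁻ ω, ENNReal.ofReal ((S (N (i + 1)) ω / M (N (i + 1)) - 1) ^ 2) ∂μ ≠ ⊤ := by
    have hs : Summable fun i : ℕ => 2 * (k : ℝ) * (1 / ((i + 1 : ℕ) : ℝ) ^ 2) :=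
      ((summable_nat_add_iff 1).2 (Real.summable_one_div_nat_pow.2 one_lt_two)).mul_left _
    refine ne_top_of_le_ne_top hs.tsum_ofReal_ne_top ?_
    exact ENNReal.tsum_le_tsum fun i => hint (i + 1) (by omega)
  have hm : ∀ i : ℕ, Measurable fun ω =>
      ENNReal.ofReal ((S (N (i + 1)) ω / M (N (i + 1)) - 1) ^ 2) := fun i =>
    ((((hmeas _).div_const _).sub_const 1).pow_const 2).ennreal_ofReal
  rw [← lintegral_tsum fun i => (hm i).aemeasurable] at hsum
  filter_upwards [ae_lt_top (Measurable.tsum hm) hsum] with ω hω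
  have h0 := ENNReal.tendsto_atTop_zero_of_tsum_ne_top hω.ne
  have h1 : Tendsto (fun i => (S (N (i + 1)) ω / M (N (i + 1)) - 1) ^ 2) atTop (𝓝 0) := by
    have := (ENNReal.tendsto_toReal ENNReal.zero_ne_top).comp h0
    refine (this.congr fun i => ?_)
    simp only [Function.comp]
    rw [ENNReal.toReal_ofReal (by positivity)]
  have h2 : Tendsto (fun i => S (N (i + 1)) ω / M (N (i + 1)) - 1) atTop (𝓝 0) := by
    have := h1.sqrt
    simp only [Real.sqrt_sq_eq_abs, Real.sqrt_zero] at this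
    exact (tendsto_zero_iff_abs_tendsto_zero _).2 this
  have h3 : Tendsto (fun i => S (N i) ω / M (N i)) atTop (𝓝 1) := by
    refine (tendsto_add_atTop_iff_nat 1).1 ?_
    simpa using h2.add_const 1
  have hind0 : ∀ p, 0 ≤ (D p).indicator (fun _ => (1 : ℝ)) ω := fun p =>
    Set.indicator_nonneg (fun _ _ => zero_le_one) _
  have hfin := tendsto_div_one_of_squares (S := fun n => S n ω) (M := M)
    (monotone_nat_of_le_succ fun n => by
      simp only [hSe, Finset.sum_range_succ]; linarith [hind0 n])
    (fun n => by rw [hSe]; exact Finset.sum_nonneg fun p _ => hind0 p)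
    hMmono N hN1 hN2 hNmin htop h3
  simpa only [hSe] using hfin

/-! ### Random digits with the expected block frequencies -/

/-- Two sequences that differ by little, relative to the second one, have quotients tending to
`1`. -/
theorem tendsto_div_one_of_close {u v : ℕ → ℝ} (hv : Tendsto v atTop atTop)
    (h : ∀ ε > 0, ∃ C, ∀ n, |u n - v n| ≤ ε * v n + C) :
    Tendsto (fun n => u n / v n) atTop (𝓝 1) := by
  rw [Metric.tendsto_atTop']
  intro ε hε
  obtain ⟨C, hC⟩ := h (ε / 4) (by positivity)
  obtain ⟨N, hN⟩ := eventually_atTop.1 (hv.eventually_ge_atTop (max 1 (4 * C / ε)))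
  refine ⟨N, fun n hn => ?_⟩
  have h1 := hN n hn.le
  have hv0 : 0 < v n := lt_of_lt_of_le zero_lt_one ((le_max_left _ _).trans h1)
  have hC' : C ≤ ε / 4 * v n := by
    have := (le_max_right _ _).trans h1
    rw [div_le_iff₀ hε] at this
    linarith
  rw [Real.dist_eq, div_sub_one hv0.ne', abs_div, abs_of_pos hv0, div_lt_iff₀ hv0]
  have := hC n
  nlinarith

/-- The positions `p` such that `p, p + 1, …, p + k - 1` all belong to `A`. -/
def blockPositions (A : Set ℕ) (k : ℕ) : Set ℕ := {p | ∀ l < k, p + l ∈ A}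

/-- The part of `blockMean Q k n` that comes from the blocks of positions inside `A`. -/
noncomputable def restrictedMean (Q : ℕ → ℕ) (A : Set ℕ) (k n : ℕ) : ℝ :=
  ∑ p ∈ Finset.range n, (blockPositions A k).indicator
    (fun p => 1 / ∏ l ∈ Finset.range k, (Q (p + l) : ℝ)) p

/-- There is a sequence of digits in which, for all orders `k` in `J`, every block of length `k`
occurs inside `A` with the frequency that is expected of random digits. -/
theorem exists_digits_with_expected_frequencies (Q : ℕ → ℕ) (hQ1 : ∀ n, 1 ≤ Q n)
    (hlim : Tendsto Q atTop atTop) (A J : Set ℕ)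
    (hdiv : ∀ k ∈ J, Tendsto (restrictedMean Q A k) atTop atTop) :
    ∃ ω : ℕ → ℕ, (∀ n, ω n < Q n) ∧ ∀ k ∈ J, ∀ B : Fin k → ℕ,
      Tendsto (fun n => (∑ p ∈ Finset.range n, ({p | ∀ l : Fin k, ω (p + l) = B l} ∩
        blockPositions A k).indicator (fun _ => (1 : ℝ)) p) / restrictedMean Q A k n)
        atTop (𝓝 1) := by
  classical
  have : ∀ n, NeZero (Q n) := fun n => ⟨by have := hQ1 n; omega⟩
  let ν : (n : ℕ) → Measure (Fin (Q n)) := fun n => (PMF.uniformOfFintype (Fin (Q n))).toMeasure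
  have : ∀ n, IsProbabilityMeasure (ν n) := fun n => by
    simp only [ν]; infer_instance
  have hν : ∀ n b, b < Q n → ν n {x | (x : ℕ) = b} = (Q n : ENNReal)⁻¹ := by
    intro n b hb
    have : {x : Fin (Q n) | (x : ℕ) = b} = {⟨b, hb⟩} := by ext x; simp [Fin.ext_iff]
    simp only [ν]
    rw [this, PMF.toMeasure_apply_singleton _ _ (MeasurableSet.singleton _)]
    simp
  -- Under `μ` the digits are independent and uniform; a typical point is the required sequence.
  let μ := Measure.infinitePi ν
  have key : ∀ k ∈ J, ∀ B : Fin k → ℕ, ∀ᵐ ω ∂μ,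
      Tendsto (fun n => (∑ p ∈ Finset.range n, ({p | ∀ l : Fin k, (ω (p + l) : ℕ) = B l} ∩
        blockPositions A k).indicator (fun _ => (1 : ℝ)) p) / restrictedMean Q A k n)
        atTop (𝓝 1) := by
    intro k hk B
    let B' : ℕ → ℕ := fun l => if h : l < k then B ⟨l, h⟩ else 0
    let t : ℕ → (i : ℕ) → Set (Fin (Q i)) := fun p i => {x | (x : ℕ) = B' (i - p)}
    have ht : ∀ p i, MeasurableSet (t p i) := fun p i => MeasurableSet.of_discrete
    let D0 : ℕ → Set ((i : ℕ) → Fin (Q i)) := fun p =>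
      (Finset.Ico p (p + k) : Set ℕ).pi (t p)
    have hD0 : ∀ p ω, ω ∈ D0 p ↔ ∀ l : Fin k, (ω (p + l) : ℕ) = B l := by
      intro p ω
      simp only [D0, Set.mem_pi, t, Finset.coe_Ico, Set.mem_Ico, Set.mem_ofPred_eq]
      constructor
      · intro h l
        have := h (p + l) ⟨by omega, by omega⟩
        simpa [B'] using this
      · rintro h i ⟨h1, h2⟩
        obtain ⟨l, rfl⟩ := Nat.exists_eq_add_of_le h1
        have hl : l < k := by omega
        simpa [B', hl] using h ⟨l, hl⟩
    -- Replacing the event by `∅` at positions whose block leaves `A` preserves independence and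
    -- makes the expected count agree with `restrictedMean` up to a bounded error.
    let D : ℕ → Set ((i : ℕ) → Fin (Q i)) := fun p => if p ∈ blockPositions A k then D0 p else ∅
    have hD0m : ∀ p, MeasurableSet (D0 p) := fun p =>
      MeasurableSet.pi (Finset.countable_toSet _) fun i _ => ht p i
    have hDm : ∀ p, MeasurableSet (D p) := by
      intro p
      simp only [D]
      split_ifs
      · exact hD0m p
      · exact MeasurableSet.empty
    have hμ0 : ∀ p, μ (D0 p) = ∏ i ∈ Finset.Ico p (p + k), ν i (t p i) := fun p =>
      Measure.infinitePi_pi ν fun i _ => ht p i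
    have hind0 : ∀ p p', p + k ≤ p' → μ (D0 p ∩ D0 p') = μ (D0 p) * μ (D0 p') := by
      intro p p' hpp
      let u : (i : ℕ) → Set (Fin (Q i)) := fun i => if i < p + k then t p i else t p' i
      have e : D0 p ∩ D0 p' =
          ((Finset.Ico p (p + k) ∪ Finset.Ico p' (p' + k) : Finset ℕ) : Set ℕ).pi u := by
        rw [Finset.coe_union, Set.union_pi]
        congr 1
        · refine Set.pi_congr rfl fun i hi => ?_
          simp only [Finset.coe_Ico, Set.mem_Ico] at hi
          simp [u, hi.2]
        · refine Set.pi_congr rfl fun i hi => ?_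
          simp only [Finset.coe_Ico, Set.mem_Ico] at hi
          simp [u, show ¬ i < p + k by omega]
      have hdisj : Disjoint (Finset.Ico p (p + k)) (Finset.Ico p' (p' + k)) := by
        rw [Finset.disjoint_left]
        intro i h1 h2
        simp only [Finset.mem_Ico] at h1 h2
        omega
      rw [e, Measure.infinitePi_pi ν fun i _ => MeasurableSet.of_discrete,
        Finset.prod_union hdisj, hμ0, hμ0]
      congr 1
      · refine Finset.prod_congr rfl fun i hi => ?_
        simp only [Finset.mem_Ico] at hi
        simp [u, hi.2]
      · refine Finset.prod_congr rfl fun i hi => ?_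
        simp only [Finset.mem_Ico] at hi
        simp [u, show ¬ i < p + k by omega]
    have hind : ∀ p p', p + k ≤ p' → μ (D p ∩ D p') = μ (D p) * μ (D p') := by
      intro p p' hpp
      simp only [D]
      split_ifs
      · exact hind0 p p' hpp
      all_goals simp
    -- the probabilities are the expected ones once the digits of `B` are available
    obtain ⟨N, hN⟩ := eventually_atTop.1
      (hlim.eventually_gt_atTop (∑ l : Fin k, B l))
    have hval : ∀ p, N ≤ p → μ.real (D p) = (blockPositions A k).indicator
        (fun p => 1 / ∏ l ∈ Finset.range k, (Q (p + l) : ℝ)) p := by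
      intro p hp
      by_cases hpA : p ∈ blockPositions A k
      · simp only [D, hpA, if_true, Set.indicator_of_mem]
        rw [Measure.real, hμ0, Finset.prod_Ico_eq_prod_range, Nat.add_sub_cancel_left,
          ENNReal.toReal_prod, one_div, ← Finset.prod_inv_distrib]
        refine Finset.prod_congr rfl fun l hl => ?_
        have hl' := Finset.mem_range.1 hl
        have hb : B' l < Q (p + l) := by
          refine lt_of_le_of_lt ?_ (hN (p + l) (by omega))
          simp only [B', hl', dif_pos]
          exact Finset.single_le_sum (f := fun l => B l) (fun _ _ => Nat.zero_le _)
            (Finset.mem_univ _)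
        have : t p (p + l) = {x : Fin (Q (p + l)) | (x : ℕ) = B' l} := by simp [t]
        rw [this, hν _ _ hb]
        simp
      · simp [D, hpA]
    have hclose : ∃ C, ∀ n, |∑ p ∈ Finset.range n, μ.real (D p) - restrictedMean Q A k n| ≤ C := by
      refine ⟨∑ p ∈ Finset.range N, |μ.real (D p) - (blockPositions A k).indicator
        (fun p => 1 / ∏ l ∈ Finset.range k, (Q (p + l) : ℝ)) p|, fun n => ?_⟩
      rw [restrictedMean, ← Finset.sum_sub_distrib]
      refine (Finset.abs_sum_le_sum_abs _ _).trans ?_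
      rw [← Finset.sum_filter_add_sum_filter_not (Finset.range n) (fun p => p < N)]
      have h0 : ∑ p ∈ (Finset.range n).filter (fun p => ¬ p < N),
          |μ.real (D p) - (blockPositions A k).indicator
            (fun p => 1 / ∏ l ∈ Finset.range k, (Q (p + l) : ℝ)) p| = 0 := by
        refine Finset.sum_eq_zero fun p hp => ?_
        rw [hval p (by simpa using (Finset.mem_filter.1 hp).2)]
        simp
      rw [h0, add_zero]
      refine Finset.sum_le_sum_of_subset_of_nonneg ?_ fun _ _ _ => abs_nonneg _
      intro p hp
      simpa using (Finset.mem_filter.1 hp).2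
    obtain ⟨C, hC⟩ := hclose
    have hdk := hdiv k hk
    have hMtop : Tendsto (fun n => ∑ p ∈ Finset.range n, μ.real (D p)) atTop atTop := by
      refine tendsto_atTop_mono (fun n => ?_) (tendsto_atTop_add_const_right _ (-C) hdk)
      have := (abs_le.1 (hC n)).1
      linarith
    have hratio : Tendsto (fun n => (∑ p ∈ Finset.range n, μ.real (D p)) /
        restrictedMean Q A k n) atTop (𝓝 1) := by
      refine tendsto_div_one_of_close hdk fun ε hε => ⟨C, fun n => (hC n).trans ?_⟩
      have : 0 ≤ restrictedMean Q A k n := Finset.sum_nonneg fun p _ =>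
        Set.indicator_nonneg (fun p _ => by positivity) _
      nlinarith
    filter_upwards [ae_tendsto_count_div μ k D hDm hind hMtop] with ω hω
    have hprod := hω.mul hratio
    rw [one_mul] at hprod
    refine hprod.congr' ?_
    filter_upwards [hMtop.eventually_gt_atTop 0] with n hn
    rw [div_mul_div_cancel₀ hn.ne']
    congr 1
    refine Finset.sum_congr rfl fun p _ => ?_
    by_cases hpA : p ∈ blockPositions A k
    · by_cases hpB : ω ∈ D0 p
      · have h2 := (hD0 p ω).1 hpB
        rw [Set.indicator_of_mem, Set.indicator_of_mem]
        · exact ⟨h2, hpA⟩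
        · simpa [D, hpA] using hpB
      · have h2 := mt (hD0 p ω).2 hpB
        rw [Set.indicator_of_notMem, Set.indicator_of_notMem]
        · exact fun h => h2 h.1
        · simpa [D, hpA] using hpB
    · rw [Set.indicator_of_notMem, Set.indicator_of_notMem]
      · exact fun h => hpA h.2
      · simp [D, hpA]
  -- There are only countably many orders and blocks, so one point serves them all.
  have hall : ∀ᵐ ω ∂μ, ∀ k, k ∈ J → ∀ B : Fin k → ℕ,
      Tendsto (fun n => (∑ p ∈ Finset.range n, ({p | ∀ l : Fin k, (ω (p + l) : ℕ) = B l} ∩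
        blockPositions A k).indicator (fun _ => (1 : ℝ)) p) / restrictedMean Q A k n)
        atTop (𝓝 1) := by
    rw [ae_all_iff]
    intro k
    by_cases hk : k ∈ J
    · have := ae_all_iff.2 (key k hk)
      filter_upwards [this] with ω hω _ using hω
    · exact Eventually.of_forall fun ω h => absurd h hk
  obtain ⟨ω, hω⟩ := hall.exists
  exact ⟨fun n => ω n, fun n => (ω n).2, hω⟩

/-! ### Digits, shifts and distances -/

theorem shiftMap_nonneg (Q : ℕ → ℕ) (n : ℕ) (x : ℝ) : 0 ≤ shiftMap Q n x := Int.fract_nonneg _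

theorem shiftMap_lt_one (Q : ℕ → ℕ) (n : ℕ) (x : ℝ) : shiftMap Q n x < 1 := Int.fract_lt_one _

theorem shiftMap_succ (Q : ℕ → ℕ) (n : ℕ) (x : ℝ) :
    shiftMap Q (n + 1) x = Q n * shiftMap Q n x - cantorDigit Q x n := by
  have h0 : 0 ≤ (Q n : ℝ) * shiftMap Q n x := mul_nonneg (by positivity) (shiftMap_nonneg Q n x)
  have hle : (cantorDigit Q x n : ℝ) ≤ Q n * shiftMap Q n x := Nat.floor_le h0
  have hlt : (Q n : ℝ) * shiftMap Q n x < cantorDigit Q x n + 1 := Nat.lt_floor_add_one _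
  rw [shiftMap, Int.fract_eq_iff]
  refine ⟨by linarith, by linarith,
    Q n * ⌊(∏ j ∈ Finset.range n, (Q j : ℝ)) * x⌋ + cantorDigit Q x n, ?_⟩
  have : shiftMap Q n x = (∏ j ∈ Finset.range n, (Q j : ℝ)) * x -
    ⌊(∏ j ∈ Finset.range n, (Q j : ℝ)) * x⌋ := rfl
  rw [this, Finset.prod_range_succ]
  push_cast
  ring

theorem cantorDigit_lt {Q : ℕ → ℕ} {n : ℕ} (hQ : 1 ≤ Q n) (x : ℝ) : cantorDigit Q x n < Q n := by
  have h0 : 0 ≤ (Q n : ℝ) * shiftMap Q n x := mul_nonneg (by positivity) (shiftMap_nonneg Q n x)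
  have hQ' : (1 : ℝ) ≤ Q n := by exact_mod_cast hQ
  rw [cantorDigit, Nat.floor_lt h0]
  nlinarith [shiftMap_lt_one Q n x]

/-- Each common digit cancels in the difference of the two recursions, so that a step only
multiplies by the base. On `[0, 1)` the recursion starts from the numbers themselves. -/
theorem shiftMap_sub_of_digits_eq {Q : ℕ → ℕ} {x y : ℝ} (hx : x ∈ Set.Ico (0 : ℝ) 1)
    (hy : y ∈ Set.Ico (0 : ℝ) 1) {n : ℕ} (h : ∀ m < n, cantorDigit Q x m = cantorDigit Q y m) :
    shiftMap Q n x - shiftMap Q n y = (∏ j ∈ Finset.range n, (Q j : ℝ)) * (x - y) := by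
  induction n with
  | zero => simp [shiftMap, Int.fract_eq_self.2 ⟨hx.1, hx.2⟩, Int.fract_eq_self.2 ⟨hy.1, hy.2⟩]
  | succ n ih =>
    have ih' := ih fun m hm => h m (by omega)
    rw [shiftMap_succ, shiftMap_succ, h n (by omega), Finset.prod_range_succ]
    linear_combination (Q n : ℝ) * ih'

theorem prod_mul_sub_of_digits_eq {Q : ℕ → ℕ} {x y : ℝ} (hx : x ∈ Set.Ico (0 : ℝ) 1)
    (hy : y ∈ Set.Ico (0 : ℝ) 1) {n : ℕ} (h : ∀ m < n, cantorDigit Q x m = cantorDigit Q y m) :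
    (∏ j ∈ Finset.range (n + 1), (Q j : ℝ)) * (x - y) =
      ((cantorDigit Q x n : ℝ) - cantorDigit Q y n) +
        (shiftMap Q (n + 1) x - shiftMap Q (n + 1) y) := by
  have h1 := shiftMap_sub_of_digits_eq hx hy h
  rw [shiftMap_succ, shiftMap_succ, Finset.prod_range_succ]
  linear_combination -(Q n : ℝ) * h1

theorem two_pow_le_prod {Q : ℕ → ℕ} (hQ : IsBasicSequence Q) (n : ℕ) :
    (2 : ℝ) ^ n ≤ ∏ j ∈ Finset.range n, (Q j : ℝ) := by
  rw [← Finset.card_range n, ← Finset.prod_const, Finset.card_range]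
  exact Finset.prod_le_prod (fun _ _ => by norm_num) fun j _ => by exact_mod_cast hQ j

/-- Every admissible sequence of digits is the digit sequence of a number in `[0, 1)`. -/
theorem exists_cantorDigit_eq {Q : ℕ → ℕ} (hQ : IsBasicSequence Q) {E : ℕ → ℕ}
    (hE : ∀ n, E n < Q n) (hfreq : ∃ᶠ n in atTop, E n ≠ Q n - 1) :
    ∃ x ∈ Set.Ico (0 : ℝ) 1, cantorDigit Q x = E := by
  set P : ℕ → ℝ := fun n => ∏ j ∈ Finset.range n, (Q j : ℝ) with hP
  have hPpos : ∀ n, 0 < P n := fun n => lt_of_lt_of_le (by positivity) (two_pow_le_prod hQ n)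
  have hPs : ∀ n, P (n + 1) = P n * Q n := fun n => by simp [hP, Finset.prod_range_succ]
  have hQ0 : ∀ n, (2 : ℝ) ≤ Q n := fun n => by exact_mod_cast hQ n
  have hstep : ∀ m, 1 / P m - 1 / P (m + 1) = ((Q m : ℝ) - 1) / P (m + 1) := by
    intro m
    have h1 := (hPpos m).ne'
    have h2 : (Q m : ℝ) ≠ 0 := by linarith [hQ0 m]
    rw [hPs]
    field_simp
  have hPinv : Tendsto (fun n => 1 / P n) atTop (𝓝 0) := by
    simp only [one_div]
    exact (tendsto_atTop_mono (two_pow_le_prod hQ)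
      (tendsto_pow_atTop_atTop_of_one_lt (by norm_num))).inv_tendsto_atTop
  have htel : HasSum (fun m => ((Q m : ℝ) - 1) / P (m + 1)) 1 := by
    rw [hasSum_iff_tendsto_nat_of_nonneg]
    · simp only [← hstep, Finset.sum_range_sub']
      simpa [hP] using hPinv.const_sub (1 / P 0)
    · exact fun m => div_nonneg (by linarith [hQ0 m]) (hPpos _).le
  have hEle : ∀ m, (E m : ℝ) ≤ Q m - 1 := fun m => by
    have : (E m : ℝ) + 1 ≤ Q m := by exact_mod_cast hE m
    linarith
  have hle : ∀ m, (E m : ℝ) / P (m + 1) ≤ ((Q m : ℝ) - 1) / P (m + 1) := fun m =>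
    div_le_div_of_nonneg_right (hEle m) (hPpos _).le
  have h0 : ∀ m, 0 ≤ (E m : ℝ) / P (m + 1) := fun m => div_nonneg (by positivity) (hPpos _).le
  have hsum : Summable fun m => (E m : ℝ) / P (m + 1) := Summable.of_nonneg_of_le h0 hle htel.summable
  obtain ⟨m, hm⟩ := hfreq.exists
  -- The maximal digits sum to exactly `1`, so a single smaller digit brings the sum below `1`.
  have hlt : (E m : ℝ) / P (m + 1) < ((Q m : ℝ) - 1) / P (m + 1) := by
    refine div_lt_div_of_pos_right ?_ (hPpos _)
    have h1 : E m + 1 < Q m := by have := hE m; omega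
    have : (E m : ℝ) + 1 < Q m := by exact_mod_cast h1
    linarith
  have hx1 := hasSum_lt hle hlt hsum.hasSum htel
  have hx0 : 0 ≤ ∑' m, (E m : ℝ) / P (m + 1) := tsum_nonneg h0
  refine ⟨_, ⟨hx0, hx1⟩, ((isCantorExpansion_iff hQ _ E).1 ⟨hE, hfreq, ?_⟩).symm⟩
  rw [Int.floor_eq_zero_iff.2 ⟨hx0, hx1⟩]
  simpa using hsum.hasSum

/-! ### Hausdorff dimension of sets with restricted digits -/

/-- If `|y - y'| ≤ K |g y - g y'| ^ r` on `s`, then `dimH s ≤ dimH (g '' s) / r`. -/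
theorem dimH_le_dimH_image_div {g : ℝ → ℝ} {s : Set ℝ} {K r : NNReal} (hr : 0 < r)
    (h : ∀ y ∈ s, ∀ z ∈ s, |y - z| ≤ K * |g y - g z| ^ (r : ℝ)) :
    dimH s ≤ dimH (g '' s) / r := by
  have hinj : Set.InjOn g s := by
    intro y hy z hz hyz
    have := h y hy z hz
    rw [hyz, sub_self, abs_zero, Real.zero_rpow (by exact_mod_cast hr.ne'), mul_zero] at this
    exact sub_eq_zero.1 (abs_nonpos_iff.1 this)
  have hleft := hinj.leftInvOn_invFunOn
  have hH : HolderOnWith K r (Function.invFunOn g s) (g '' s) := by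
    rintro _ ⟨y, hy, rfl⟩ _ ⟨z, hz, rfl⟩
    rw [hleft hy, hleft hz, edist_dist, edist_dist, Real.dist_eq, Real.dist_eq,
      ENNReal.ofReal_rpow_of_nonneg (abs_nonneg _) r.coe_nonneg, ← ENNReal.ofReal_coe_nnreal,
      ← ENNReal.ofReal_mul K.coe_nonneg]
    exact ENNReal.ofReal_le_ofReal (h y hy z hz)
  have := hH.dimH_image_le hr
  rwa [hleft.image_image] at this

/-- The set of numbers whose `n`th digit is restricted to `c n` consecutive values has Hausdorff
dimension `1` if the numbers of admissible blocks of digits are large enough. -/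
theorem one_le_dimH_digits {Q c e : ℕ → ℕ} (hQ : IsBasicSequence Q) (hc1 : ∀ n, 1 ≤ c n)
    (hc2 : ∀ n, 2 * c n ≤ Q n) (hec : ∀ n, e n + c n ≤ Q n)
    (hfreq : ∃ᶠ n in atTop, e n + c n < Q n) (M : ℕ) (hM : ∀ n, 2 ≤ c n → Q n ≤ M * c n)
    (hgrow : ∀ r : ℝ, 0 < r → r < 1 → ∃ K : ℝ, 0 < K ∧ ∀ n,
      (∏ j ∈ Finset.range n, (Q j : ℝ)) ^ r ≤ K * ∏ j ∈ Finset.range n, (c j : ℝ)) :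
    1 ≤ dimH {x | x ∈ Set.Ico (0 : ℝ) 1 ∧
      ∀ n, e n ≤ cantorDigit Q x n ∧ cantorDigit Q x n < e n + c n} := by
  set S := {x | x ∈ Set.Ico (0 : ℝ) 1 ∧
      ∀ n, e n ≤ cantorDigit Q x n ∧ cantorDigit Q x n < e n + c n} with hS
  set P : ℕ → ℝ := fun n => ∏ j ∈ Finset.range n, (Q j : ℝ) with hP
  set C : ℕ → ℝ := fun n => ∏ j ∈ Finset.range n, (c j : ℝ) with hC
  have hPpos : ∀ n, 0 < P n := fun n => lt_of_lt_of_le (by positivity) (two_pow_le_prod hQ n)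
  have hc1' : ∀ n, (1 : ℝ) ≤ c n := fun n => by exact_mod_cast hc1 n
  have hCpos : ∀ n, 0 < C n := fun n => Finset.prod_pos fun j _ => by linarith [hc1' j]
  have hPs : ∀ n, P (n + 1) = P n * Q n := fun n => by simp [hP, Finset.prod_range_succ]
  have hCs : ∀ n, C (n + 1) = C n * c n := fun n => by simp [hC, Finset.prod_range_succ]
  -- Since `c n = 1` is allowed, `c` need not be a basic sequence. Divergence of its products is
  -- what makes `c`-digits determine a number.
  have hCtop : Tendsto C atTop atTop := by
    obtain ⟨K, hK0, hK⟩ := hgrow (1 / 2) (by norm_num) (by norm_num)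
    have h1 : Tendsto (fun n => P n ^ (1 / 2 : ℝ)) atTop atTop :=
      (tendsto_rpow_atTop (by norm_num)).comp (tendsto_atTop_mono (two_pow_le_prod hQ)
        (tendsto_pow_atTop_atTop_of_one_lt (by norm_num)))
    refine tendsto_atTop_mono (fun n => ?_) (h1.atTop_div_const hK0)
    rw [div_le_iff₀ hK0, mul_comm]
    exact hK n
  -- the number with the digits that are encoded by `y`
  have hg : ∀ y : ℝ, ∃ x ∈ Set.Ico (0 : ℝ) 1, cantorDigit Q x = fun n => e n + cantorDigit c y n := by
    intro y
    refine exists_cantorDigit_eq hQ (fun n => ?_) (hfreq.mono fun n hn => ?_)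
    · have := cantorDigit_lt (hc1 n) y
      have := hec n
      omega
    · have := cantorDigit_lt (hc1 n) y
      omega
  choose g hg01 hgd using hg
  have hgS : ∀ y, g y ∈ S := fun y => ⟨hg01 y, fun n => by
    have := cantorDigit_lt (hc1 n) y
    rw [hgd]
    constructor <;> simp only <;> omega⟩
  -- Because admissible digits fill at most half of each base, two tails differ by at most `1 / 2`
  -- and cannot cancel a difference of at least `1` in the first distinct digit.
  have hshift : ∀ x ∈ S, ∀ z ∈ S, ∀ m, |shiftMap Q m x - shiftMap Q m z| ≤ 1 / 2 := by
    have aux : ∀ x ∈ S, ∀ z ∈ S, ∀ m, shiftMap Q m x - shiftMap Q m z ≤ 1 / 2 := by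
      intro x hx z hz m
      have h1 := shiftMap_succ Q m x
      have h2 := shiftMap_succ Q m z
      have h3 : (cantorDigit Q x m : ℝ) + 1 ≤ e m + c m := by exact_mod_cast (hx.2 m).2
      have h4 : (e m : ℝ) ≤ cantorDigit Q z m := by exact_mod_cast (hz.2 m).1
      have h5 : 2 * (c m : ℝ) ≤ Q m := by exact_mod_cast hc2 m
      have h6 := shiftMap_lt_one Q (m + 1) x
      have h7 := shiftMap_nonneg Q (m + 1) z
      have hQm : (2 : ℝ) ≤ Q m := by exact_mod_cast hQ m
      by_contra! hcon
      nlinarith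
    intro x hx z hz m
    rw [abs_le]
    constructor
    · linarith [aux z hz x hx m]
    · exact aux x hx z hz m
  refine ENNReal.le_of_forall_nnreal_lt fun r hr1 => ?_
  rcases eq_zero_or_pos r with rfl | hr0
  · simp
  have hr1' : (r : ℝ) < 1 := by exact_mod_cast hr1
  have hr0' : (0 : ℝ) < r := by exact_mod_cast hr0
  obtain ⟨K, hK0, hK⟩ := hgrow r hr0' hr1'
  have hest : ∀ y ∈ Set.Ico (0 : ℝ) 1, ∀ z ∈ Set.Ico (0 : ℝ) 1,
      |y - z| ≤ (Real.toNNReal (4 * (M + 1) * K) : NNReal) * |g y - g z| ^ (r : ℝ) := by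
    intro y hy z hz
    rw [Real.coe_toNNReal _ (by positivity)]
    rcases eq_or_ne y z with rfl | hyz
    · rw [sub_self, abs_zero]; positivity
    have hex : ∃ n, cantorDigit c y n ≠ cantorDigit c z n := by
      by_contra! hall
      have hb : ∀ n, C n * |y - z| ≤ 1 := by
        intro n
        have := shiftMap_sub_of_digits_eq (n := n) hy hz fun m _ => hall m
        rw [← abs_of_pos (hCpos n), ← abs_mul, ← this, abs_le]
        have h1 := shiftMap_nonneg c n y
        have h2 := shiftMap_nonneg c n z
        have h3 := shiftMap_lt_one c n y
        have h4 := shiftMap_lt_one c n z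
        constructor <;> linarith
      have hpos : 0 < |y - z| := abs_pos.2 (sub_ne_zero.2 hyz)
      obtain ⟨n, hn⟩ := ((hCtop.atTop_mul_const hpos).eventually_gt_atTop 1).exists
      linarith [hb n]
    classical
    set n := Nat.find hex with hn
    have hne : cantorDigit c y n ≠ cantorDigit c z n := Nat.find_spec hex
    have heq : ∀ m < n, cantorDigit c y m = cantorDigit c z m := fun m hm => by
      have := Nat.find_min hex hm
      simpa using this
    have heqQ : ∀ m < n, cantorDigit Q (g y) m = cantorDigit Q (g z) m := fun m hm => by
      rw [hgd, hgd]; simp only; rw [heq m hm]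
    -- Two different digits exist at `n`, which is the case where `Q n ≤ M * c n` is available.
    have hcn : 2 ≤ c n := by
      have h1 := cantorDigit_lt (hc1 n) y
      have h2 := cantorDigit_lt (hc1 n) z
      omega
    -- The size of the digit difference is kept: `c n` may be unbounded, and estimating `D` by `1`
    -- from below and by `c n` from above would lose the factor `c n`.
    set D : ℝ := |(cantorDigit c y n : ℝ) - cantorDigit c z n| with hD
    have hD1 : 1 ≤ D := by
      have : (1 : ℤ) ≤ |(cantorDigit c y n : ℤ) - cantorDigit c z n| := by
        apply Int.one_le_abs
        omega
      have h2 : ((1 : ℤ) : ℝ) ≤ (|(cantorDigit c y n : ℤ) - cantorDigit c z n| : ℤ) := by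
        exact_mod_cast this
      push_cast at h2
      exact h2
    have hDc : D ≤ c n := by
      have h1 : (cantorDigit c y n : ℝ) ≤ c n := by exact_mod_cast (cantorDigit_lt (hc1 n) y).le
      have h2 : (cantorDigit c z n : ℝ) ≤ c n := by exact_mod_cast (cantorDigit_lt (hc1 n) z).le
      have h3 : (0 : ℝ) ≤ cantorDigit c y n := by positivity
      have h4 : (0 : ℝ) ≤ cantorDigit c z n := by positivity
      rw [hD, abs_le]
      constructor <;> linarith
    have hup : C (n + 1) * |y - z| ≤ 2 * D := by
      have h0 := prod_mul_sub_of_digits_eq hy hz heq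
      have h1 := shiftMap_nonneg c (n + 1) y
      have h2 := shiftMap_nonneg c (n + 1) z
      have h3 := shiftMap_lt_one c (n + 1) y
      have h4 := shiftMap_lt_one c (n + 1) z
      have h5 : |shiftMap c (n + 1) y - shiftMap c (n + 1) z| ≤ 1 := by
        rw [abs_le]; constructor <;> linarith
      rw [← abs_of_pos (hCpos (n + 1)), ← abs_mul]
      calc |C (n + 1) * (y - z)| = _ := by rw [h0]
        _ ≤ D + 1 := (abs_add_le _ _).trans (by linarith)
        _ ≤ _ := by linarith
    have hlow : D / 2 ≤ P (n + 1) * |g y - g z| := by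
      have h0 := prod_mul_sub_of_digits_eq (hg01 y) (hg01 z) heqQ
      have h1 := hshift _ (hgS y) _ (hgS z) (n + 1)
      rw [hgd, hgd] at h0
      push_cast at h0
      rw [← abs_of_pos (hPpos (n + 1)), ← abs_mul]
      have h2 : (cantorDigit c y n : ℝ) - cantorDigit c z n =
          P (n + 1) * (g y - g z) - (shiftMap Q (n + 1) (g y) - shiftMap Q (n + 1) (g z)) := by
        rw [h0]; ring
      have h3 : D ≤ |P (n + 1) * (g y - g z)| + 1 / 2 := by
        rw [hD, h2]
        exact (abs_sub _ _).trans (by linarith)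
      linarith
    have hcn0 : (0 : ℝ) < c n := by linarith [hc1' n]
    have hMn : (Q n : ℝ) ≤ (M + 1) * c n := by
      have : (Q n : ℝ) ≤ M * c n := by exact_mod_cast hM n hcn
      linarith
    have hQn : (0 : ℝ) < Q n := by
      have : (2 : ℝ) ≤ Q n := by exact_mod_cast hQ n
      linarith
    have hlow2 : D / c n * (1 / (2 * (M + 1))) * (1 / P n) ≤ |g y - g z| := by
      rw [hPs] at hlow
      have h1 : D / 2 ≤ P n * ((M + 1) * c n) * |g y - g z| := by
        refine hlow.trans ?_
        gcongr
      have h2 := hPpos n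
      rw [div_mul_div_comm, div_mul_div_comm, div_le_iff₀ (by positivity)]
      linarith
    -- A factor in `[0, 1]` does not decrease when raised to the power `r < 1`; the growth
    -- hypothesis is thus needed only for `P n`.
    have hz1 : D / c n * (1 / (2 * (M + 1))) ≤ 1 := by
      have h1 : D / c n ≤ 1 := (div_le_one hcn0).2 hDc
      have h2 : (1 : ℝ) / (2 * (M + 1)) ≤ 1 := by
        rw [div_le_one (by positivity)]
        have : (0 : ℝ) ≤ M := by positivity
        linarith
      have h3 : 0 ≤ D / c n := by positivity
      have h4 : (0 : ℝ) ≤ 1 / (2 * (M + 1)) := by positivity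
      nlinarith
    have hpow : D / c n * (1 / (2 * (M + 1))) * (1 / (K * C n)) ≤ |g y - g z| ^ (r : ℝ) := by
      have h2 := hPpos n
      calc D / c n * (1 / (2 * (M + 1))) * (1 / (K * C n))
          ≤ (D / c n * (1 / (2 * (M + 1)))) ^ (r : ℝ) * (1 / P n ^ (r : ℝ)) := by
            gcongr
            · exact Real.self_le_rpow_of_le_one (by positivity) hz1 hr1'.le
            · exact hK n
        _ = (D / c n * (1 / (2 * (M + 1))) * (1 / P n)) ^ (r : ℝ) := by
            rw [Real.mul_rpow (x := D / c n * (1 / (2 * (M + 1)))) (by positivity) (by positivity), one_div (P n),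
              Real.inv_rpow h2.le]
            simp only [one_div]
        _ ≤ _ := by gcongr
    have hCn := hCpos n
    calc |y - z| ≤ 2 * D / C (n + 1) := by
          rw [le_div_iff₀ (hCpos _), mul_comm]; exact hup
      _ = 4 * (M + 1) * K * (D / c n * (1 / (2 * (M + 1))) * (1 / (K * C n))) := by
          rw [hCs]
          field_simp
          ring
      _ ≤ _ := by gcongr
  have h1 := dimH_le_dimH_image_div hr0 hest
  have h2 : dimH (Set.Ico (0 : ℝ) 1) = 1 := by
    rw [Real.dimH_of_nonempty_interior (by rw [interior_Ico]; exact ⟨1 / 2, by norm_num, by norm_num⟩)]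
    simp
  have h3 : dimH (g '' Set.Ico (0 : ℝ) 1) ≤ dimH S :=
    dimH_mono (Set.image_subset_iff.2 fun y _ => hgS y)
  rw [h2, ENNReal.le_div_iff_mul_le (Or.inl (by exact_mod_cast hr0.ne'))
    (Or.inl ENNReal.coe_ne_top), one_mul] at h1
  exact h1.trans h3

/-! ### Criteria for normality and against distribution normality -/

theorem natCard_subtype_lt_eq_sum (p : ℕ → Prop) (n : ℕ) :
    (Nat.card {m : ℕ // m < n ∧ p m} : ℝ) =
      ∑ m ∈ Finset.range n, {m | p m}.indicator (fun _ => (1 : ℝ)) m := by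
  classical
  rw [Nat.subtype_card ((Finset.range n).filter p) (by simp), Finset.card_filter]
  push_cast
  refine Finset.sum_congr rfl fun m _ => ?_
  simp [Set.indicator_apply]

theorem blockMean_nonneg (Q : ℕ → ℕ) (k n : ℕ) : 0 ≤ blockMean Q k n :=
  Finset.sum_nonneg fun _ _ => by positivity

theorem restrictedMean_le_blockMean (Q : ℕ → ℕ) (A : Set ℕ) (k n : ℕ) :
    restrictedMean Q A k n ≤ blockMean Q k n :=
  Finset.sum_le_sum fun _ _ => Set.indicator_le_self' (fun _ _ => by positivity) _

/-- Digits that have the expected frequencies inside `A` and tend to infinity outside of `A` are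
the digits of a number that is normal of order `k`. -/
theorem mem_normalOfOrder_of_digits {Q : ℕ → ℕ} {A : Set ℕ} {k : ℕ} {ω c : ℕ → ℕ} {x : ℝ}
    (hdiv : KDivergent Q k)
    (hbad : ∀ ε > 0, ∃ C, ∀ n, blockMean Q k n - restrictedMean Q A k n ≤ ε * blockMean Q k n + C)
    (hω : ∀ B : Fin k → ℕ,
      Tendsto (fun n => (∑ p ∈ Finset.range n, ({p | ∀ l : Fin k, ω (p + l) = B l} ∩
        blockPositions A k).indicator (fun _ => (1 : ℝ)) p) / restrictedMean Q A k n)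
        atTop (𝓝 1))
    (hc : Tendsto c atTop atTop) (hxA : ∀ n ∈ A, cantorDigit Q x n = ω n)
    (hxA' : ∀ n ∉ A, c n ≤ cantorDigit Q x n) :
    x ∈ normalOfOrder Q k := by
  intro B
  set R := restrictedMean Q A k
  set U : ℕ → ℝ := fun n => ∑ p ∈ Finset.range n, ({p | ∀ l : Fin k, ω (p + l) = B l} ∩
        blockPositions A k).indicator (fun _ => (1 : ℝ)) p with hU
  have hRb : Tendsto (fun n => R n / blockMean Q k n) atTop (𝓝 1) := by
    refine tendsto_div_one_of_close hdiv fun ε hε => ?_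
    obtain ⟨C, hC⟩ := hbad ε hε
    refine ⟨C, fun n => ?_⟩
    rw [abs_sub_comm, abs_of_nonneg (sub_nonneg.2 (restrictedMean_le_blockMean Q A k n))]
    exact hC n
  have hRtop : ∀ᶠ n in atTop, R n ≠ 0 := by
    filter_upwards [hRb.eventually (lt_mem_nhds zero_lt_one)] with n hn hR
    rw [hR, zero_div] at hn
    exact hn.false
  have hUb : Tendsto (fun n => U n / blockMean Q k n) atTop (𝓝 1) := by
    have := (hω B).mul hRb
    rw [one_mul] at this
    refine this.congr' ?_
    filter_upwards [hRtop] with n hn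
    exact div_mul_div_cancel₀ hn
  -- The sum of `B` bounds every entry of `B`. From `N` on, digits outside of `A` exceed all
  -- entries, so each occurrence of `B` lies inside `A`.
  obtain ⟨N, hN⟩ := eventually_atTop.1 (hc.eventually_gt_atTop (∑ l : Fin k, B l))
  have hterm : ∀ p, N ≤ p → {p | ∀ l : Fin k, cantorDigit Q x (p + l) = B l}.indicator
      (fun _ => (1 : ℝ)) p = ({p | ∀ l : Fin k, ω (p + l) = B l} ∩
        blockPositions A k).indicator (fun _ => (1 : ℝ)) p := by
    intro p hp
    have hiff : p ∈ {p | ∀ l : Fin k, cantorDigit Q x (p + l) = B l} ↔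
        p ∈ {p | ∀ l : Fin k, ω (p + l) = B l} ∩ blockPositions A k := by
      constructor
      · intro h
        have hA : p ∈ blockPositions A k := by
          intro l hl
          by_contra hn
          have h1 := hxA' _ hn
          have h2 : cantorDigit Q x (p + l) = B ⟨l, hl⟩ := h ⟨l, hl⟩
          have h3 := hN (p + l) (by omega)
          have h4 : B ⟨l, hl⟩ ≤ ∑ l : Fin k, B l :=
            Finset.single_le_sum (f := fun l => B l) (fun _ _ => Nat.zero_le _) (Finset.mem_univ _)
          omega
        exact ⟨fun l => by rw [← hxA _ (hA l l.2)]; exact h l, hA⟩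
      · rintro ⟨h, hA⟩ l
        rw [hxA _ (hA l l.2)]
        exact h l
    by_cases h : p ∈ {p | ∀ l : Fin k, cantorDigit Q x (p + l) = B l}
    · rw [Set.indicator_of_mem h, Set.indicator_of_mem (hiff.1 h)]
    · rw [Set.indicator_of_notMem h, Set.indicator_of_notMem (mt hiff.2 h)]
  have hclose : ∃ C : ℝ, ∀ n, |(blockCount Q B x n : ℝ) - U n| ≤ C := by
    refine ⟨∑ p ∈ Finset.range N, |{p | ∀ l : Fin k, cantorDigit Q x (p + l) = B l}.indicator
      (fun _ => (1 : ℝ)) p - ({p | ∀ l : Fin k, ω (p + l) = B l} ∩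
        blockPositions A k).indicator (fun _ => (1 : ℝ)) p|, fun n => ?_⟩
    rw [blockCount, natCard_subtype_lt_eq_sum, hU]
    simp only
    rw [← Finset.sum_sub_distrib]
    refine (Finset.abs_sum_le_sum_abs _ _).trans ?_
    rw [← Finset.sum_filter_add_sum_filter_not (Finset.range n) (fun p => p < N)]
    rw [Finset.sum_eq_zero (s := (Finset.range n).filter (fun p => ¬ p < N)), add_zero]
    · refine Finset.sum_le_sum_of_subset_of_nonneg ?_ fun _ _ _ => abs_nonneg _
      intro p hp
      simpa using (Finset.mem_filter.1 hp).2
    · intro p hp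
      rw [hterm p (by simpa using (Finset.mem_filter.1 hp).2), sub_self, abs_zero]
  obtain ⟨C, hC⟩ := hclose
  have hzero : Tendsto (fun n => ((blockCount Q B x n : ℝ) - U n) / blockMean Q k n) atTop
      (𝓝 0) := by
    refine squeeze_zero_norm (fun n => ?_) (Tendsto.const_div_atTop hdiv C)
    rw [norm_div, Real.norm_eq_abs, Real.norm_of_nonneg (blockMean_nonneg Q k n)]
    exact div_le_div_of_nonneg_right (hC n) (blockMean_nonneg Q k n)
  have := hUb.add hzero
  rw [add_zero] at this
  exact this.congr fun n => by rw [← add_div]; congr 1; ring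

/-- If the orbit of `x` visits `[3/4, 1)` only at finitely many times outside of a set `A` whose
lower density is zero, then it is not uniformly distributed. -/
theorem notMem_distributionNormal_of_sparse {Q : ℕ → ℕ} {A : Set ℕ} {x : ℝ} {N : ℕ}
    (hdens : ∀ ε > 0, ∃ᶠ n : ℕ in atTop,
      ∑ p ∈ Finset.range n, A.indicator (fun _ => (1 : ℝ)) p ≤ ε * n)
    (hx : ∀ n ∉ A, N ≤ n → shiftMap Q n x < 3 / 4) : x ∉ distributionNormal Q := by
  intro h
  have h1 := h (3 / 4) 1 (by norm_num) (by norm_num) le_rfl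
  have h2 := h1.eventually (lt_mem_nhds (show (1 / 8 : ℝ) < 1 - 3 / 4 by norm_num))
  -- At such `n` there are at most `n / 16 + N < n / 8` visits to `[3/4, 1)`, whereas uniform
  -- distribution would eventually give more than `n / 8`.
  obtain ⟨n, hn, hn2, hn3⟩ := ((hdens (1 / 16) (by norm_num)).and_eventually
    (h2.and (eventually_gt_atTop (16 * N)))).exists
  have hn0 : (0 : ℝ) < n := by exact_mod_cast (by omega : 0 < n)
  rw [lt_div_iff₀ hn0, natCard_subtype_lt_eq_sum] at hn2
  have hle : ∑ m ∈ Finset.range n, {m | Int.fract (shiftMap Q m x) ∈ Set.Ico (3 / 4 : ℝ) 1}.indicator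
      (fun _ => (1 : ℝ)) m ≤ ∑ m ∈ Finset.range n, (A.indicator (fun _ => (1 : ℝ)) m +
        (Set.Iio N).indicator (fun _ => (1 : ℝ)) m) := by
    refine Finset.sum_le_sum fun m _ => ?_
    by_cases hmA : m ∈ A
    · have h3 : 0 ≤ (Set.Iio N).indicator (fun _ => (1 : ℝ)) m :=
        Set.indicator_nonneg (fun _ _ => zero_le_one) _
      have h4 : {m | Int.fract (shiftMap Q m x) ∈ Set.Ico (3 / 4 : ℝ) 1}.indicator
          (fun _ => (1 : ℝ)) m ≤ 1 := Set.indicator_le_self' (fun _ _ => zero_le_one) _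
      rw [Set.indicator_of_mem hmA]
      linarith
    by_cases hmN : m < N
    · rw [Set.indicator_of_notMem hmA, Set.indicator_of_mem (Set.mem_Iio.2 hmN), zero_add]
      exact Set.indicator_le_self' (fun _ _ => zero_le_one) _
    · have h5 := hx m hmA (by omega)
      rw [Set.indicator_of_notMem hmA, Set.indicator_of_notMem (s := Set.Iio N) (by simpa using hmN),
        Set.indicator_of_notMem]
      · simp
      · intro hm
        have hm' : Int.fract (shiftMap Q m x) ∈ Set.Ico (3 / 4 : ℝ) 1 := hm
        rw [Int.fract_eq_self.2 ⟨shiftMap_nonneg Q m x, shiftMap_lt_one Q m x⟩] at hm'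
        linarith [hm'.1]
  rw [Finset.sum_add_distrib] at hle
  have hN : ∑ m ∈ Finset.range n, (Set.Iio N).indicator (fun _ => (1 : ℝ)) m ≤ N := by
    rw [← Finset.sum_range_add_sum_Ico _ (show N ≤ n by omega),
      Finset.sum_eq_zero (s := Finset.Ico N n), add_zero]
    · refine (Finset.sum_le_sum fun m _ =>
        Set.indicator_le_self' (fun _ _ => zero_le_one) _).trans ?_
      simp
    · intro m hm
      exact Set.indicator_of_notMem (by simpa using (Finset.mem_Ico.1 hm).1) _
  have hn3' : 16 * (N : ℝ) < n := by exact_mod_cast hn3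
  linarith

/-! ### The general dimension theorem for a sparse set of positions -/

/-- If the digits are essentially unrestricted outside of a set `A` that carries a negligible part
of the entropy, then the products of the numbers of admissible digits grow almost as fast as the
products of the bases. -/
theorem exists_prod_rpow_le {Q c : ℕ → ℕ} {A : Set ℕ} (hQ : IsBasicSequence Q)
    (hlim : Tendsto Q atTop atTop) (hc1 : ∀ n, 1 ≤ c n) {M : ℕ} (hM : ∀ n ∉ A, Q n ≤ M * c n)
    (hent : ∀ ε > 0, ∃ C, ∀ n, ∑ p ∈ Finset.range n, A.indicator (fun p => Real.log (Q p)) p ≤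
      ε * ∑ p ∈ Finset.range n, Aᶜ.indicator (fun p => Real.log (Q p)) p + C)
    {r : ℝ} (hr0 : 0 < r) (hr1 : r < 1) :
    ∃ K : ℝ, 0 < K ∧ ∀ n,
      (∏ j ∈ Finset.range n, (Q j : ℝ)) ^ r ≤ K * ∏ j ∈ Finset.range n, (c j : ℝ) := by
  -- This choice gives `r * (1 + ε) ≤ 1 - ε`: one `ε` pays for the entropy on `A`, the other for the
  -- constant `M`.
  set ε := (1 - r) / 2 with hε
  have hε0 : 0 < ε := by rw [hε]; linarith
  obtain ⟨C, hC⟩ := hent ε hε0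
  have hQ0 : ∀ n, (2 : ℝ) ≤ Q n := fun n => by exact_mod_cast hQ n
  have hlogQ : ∀ n, 0 ≤ Real.log (Q n) := fun n => Real.log_nonneg (by linarith [hQ0 n])
  have hc0 : ∀ n, (1 : ℝ) ≤ c n := fun n => by exact_mod_cast hc1 n
  have hlogc : ∀ n, 0 ≤ Real.log (c n) := fun n => Real.log_nonneg (hc0 n)
  have hlogtop : Tendsto (fun n => Real.log (Q n)) atTop atTop :=
    Real.tendsto_log_atTop.comp (tendsto_natCast_atTop_atTop.comp hlim)
  obtain ⟨N, hN⟩ := eventually_atTop.1 (hlogtop.eventually_ge_atTop (Real.log M / ε))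
  have hstep : ∀ j, (1 - ε) * Aᶜ.indicator (fun p => Real.log (Q p)) j ≤ Real.log (c j) +
      (Set.Iio N).indicator (fun p => Real.log (Q p)) j := by
    intro j
    have h1 : 0 ≤ (Set.Iio N).indicator (fun p => Real.log (Q p)) j :=
      Set.indicator_nonneg (fun p _ => hlogQ p) _
    by_cases hj : j ∈ A
    · rw [Set.indicator_of_notMem (by simpa using hj), mul_zero]
      linarith [hlogc j]
    rw [Set.indicator_of_mem (Set.mem_compl hj)]
    rcases lt_or_ge j N with hjN | hjN
    · rw [Set.indicator_of_mem (Set.mem_Iio.2 hjN)]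
      nlinarith [hlogc j, hlogQ j]
    · have h2 := hN j hjN
      rw [div_le_iff₀ hε0] at h2
      have h3 : (Q j : ℝ) ≤ M * c j := by exact_mod_cast hM j hj
      have hcj : (0 : ℝ) < c j := by linarith [hc0 j]
      have hM0 : (M : ℝ) ≠ 0 := by
        intro hM0
        rw [hM0, zero_mul] at h3
        linarith [hQ0 j]
      have h4 : Real.log (Q j) ≤ Real.log M + Real.log (c j) := by
        rw [← Real.log_mul hM0 hcj.ne']
        exact Real.log_le_log (by linarith [hQ0 j]) h3
      linarith
  have hP : ∀ n, 0 < ∏ j ∈ Finset.range n, (Q j : ℝ) := fun n =>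
    Finset.prod_pos fun j _ => by linarith [hQ0 j]
  have hCp : ∀ n, 0 < ∏ j ∈ Finset.range n, (c j : ℝ) := fun n =>
    Finset.prod_pos fun j _ => by linarith [hc0 j]
  refine ⟨Real.exp (r * C + ∑ j ∈ Finset.range N, Real.log (Q j)), Real.exp_pos _, fun n => ?_⟩
  rw [← Real.log_le_log_iff (Real.rpow_pos_of_pos (hP n) _)
    (mul_pos (Real.exp_pos _) (hCp n)), Real.log_rpow (hP n),
    Real.log_mul (Real.exp_pos _).ne' (hCp n).ne', Real.log_exp,
    Real.log_prod fun j _ => by linarith [hQ0 j],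
    Real.log_prod fun j _ => by linarith [hc0 j]]
  have hsplit : ∑ j ∈ Finset.range n, Real.log (Q j) =
      ∑ p ∈ Finset.range n, A.indicator (fun p => Real.log (Q p)) p +
      ∑ p ∈ Finset.range n, Aᶜ.indicator (fun p => Real.log (Q p)) p := by
    rw [← Finset.sum_add_distrib]
    refine Finset.sum_congr rfl fun j _ => ?_
    exact (Set.indicator_self_add_compl_apply A (fun p => Real.log (Q p)) j).symm
  have hb : 0 ≤ ∑ p ∈ Finset.range n, Aᶜ.indicator (fun p => Real.log (Q p)) p :=
    Finset.sum_nonneg fun p _ => Set.indicator_nonneg (fun p _ => hlogQ p) _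
  have hsum := Finset.sum_le_sum fun j (_ : j ∈ Finset.range n) => hstep j
  rw [← Finset.mul_sum, Finset.sum_add_distrib] at hsum
  have hfin : ∑ j ∈ Finset.range n, (Set.Iio N).indicator (fun p => Real.log (Q p)) j ≤
      ∑ j ∈ Finset.range N, Real.log (Q j) := by
    simp only [Set.indicator_apply, Set.mem_Iio]
    rw [← Finset.sum_filter]
    refine Finset.sum_le_sum_of_subset_of_nonneg (fun j hj => ?_) fun j _ _ => hlogQ j
    simpa using (Finset.mem_filter.1 hj).2
  have h1 := hC n
  have h2 : r * (1 + ε) ≤ 1 - ε := by rw [hε]; nlinarith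
  rw [hsplit]
  nlinarith [mul_le_mul_of_nonneg_left h1 hr0.le, mul_le_mul_of_nonneg_right h2 hb]

/-- The Hausdorff dimension of the set of numbers that are normal of all orders in `J` but not
distribution normal is `1` if there is a sparse set `A` of positions, carrying a negligible part of
the entropy, that determines the asymptotics of the expected numbers of occurrences of blocks. -/
theorem dimH_normal_diff_distributionNormal {Q : ℕ → ℕ} {A J : Set ℕ} (hQ : IsBasicSequence Q)
    (hlim : Tendsto Q atTop atTop)
    (hdens : ∀ ε > 0, ∃ᶠ n : ℕ in atTop,
      ∑ p ∈ Finset.range n, A.indicator (fun _ => (1 : ℝ)) p ≤ ε * n)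
    (hent : ∀ ε > 0, ∃ C, ∀ n, ∑ p ∈ Finset.range n, A.indicator (fun p => Real.log (Q p)) p ≤
      ε * ∑ p ∈ Finset.range n, Aᶜ.indicator (fun p => Real.log (Q p)) p + C)
    (hbad : ∀ k ∈ J, ∀ ε > 0, ∃ C, ∀ n,
      blockMean Q k n - restrictedMean Q A k n ≤ ε * blockMean Q k n + C)
    (hdiv : ∀ k ∈ J, KDivergent Q k) :
    dimH ((⋂ k ∈ J, normalOfOrder Q k) \ distributionNormal Q) = 1 := by
  classical
  refine le_antisymm ((dimH_mono (Set.subset_univ _)).trans_eq Real.dimH_univ) ?_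
  have hQ1 : ∀ n, 1 ≤ Q n := fun n => by have := hQ n; omega
  have hRdiv : ∀ k ∈ J, Tendsto (restrictedMean Q A k) atTop atTop := by
    intro k hk
    obtain ⟨C, hC⟩ := hbad k hk (1 / 2) (by norm_num)
    refine tendsto_atTop_mono (fun n => ?_)
      (tendsto_atTop_add_const_right _ (-C) ((hdiv k hk).const_mul_atTop (show (0 : ℝ) < 1 / 2 by norm_num)))
    linarith [hC n]
  obtain ⟨ω, hωQ, hω⟩ := exists_digits_with_expected_frequencies Q hQ1 hlim A J hRdiv
  -- The interval `[b, 2b)` moves off to infinity, stays below `Q n / 2` once `4 ≤ Q n`, and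
  -- contains at least `Q n / 8` digits. On `A` the single admissible digit is `ω n`.
  set b : ℕ → ℕ := fun n => max 1 (Q n / 4) with hb
  set c : ℕ → ℕ := fun n => if n ∈ A then 1 else b n with hc
  set e : ℕ → ℕ := fun n => if n ∈ A then ω n else b n with he
  have hbQ : ∀ n, 2 * b n ≤ Q n := fun n => by
    have := hQ n
    simp only [hb]
    omega
  have hc1 : ∀ n, 1 ≤ c n := fun n => by
    simp only [hc, hb]
    split_ifs <;> omega
  have hc2 : ∀ n, 2 * c n ≤ Q n := fun n => by
    have := hQ n
    have := hbQ n
    simp only [hc]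
    split_ifs <;> omega
  have hec : ∀ n, e n + c n ≤ Q n := fun n => by
    have := hωQ n
    have := hbQ n
    simp only [hc, he]
    split_ifs <;> omega
  have hA'inf : ∃ᶠ n in atTop, n ∉ A := by
    rw [frequently_atTop]
    by_contra! hcon
    obtain ⟨N, hN⟩ := hcon
    obtain ⟨n, hn, hn2⟩ := ((hdens (1 / 2) (by norm_num)).and_eventually
      (eventually_gt_atTop (2 * N))).exists
    have h1 : ∑ p ∈ Finset.Ico N n, A.indicator (fun _ => (1 : ℝ)) p = n - N := by
      rw [Finset.sum_congr rfl fun p hp =>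
        Set.indicator_of_mem (hN p (Finset.mem_Ico.1 hp).1) (fun _ => (1 : ℝ))]
      simp [Nat.cast_sub (show N ≤ n by omega)]
    have h2 : 0 ≤ ∑ p ∈ Finset.range N, A.indicator (fun _ => (1 : ℝ)) p :=
      Finset.sum_nonneg fun p _ => Set.indicator_nonneg (fun _ _ => zero_le_one) _
    rw [← Finset.sum_range_add_sum_Ico _ (show N ≤ n by omega), h1] at hn
    have hn2' : 2 * (N : ℝ) < n := by exact_mod_cast hn2
    linarith
  have hfreq : ∃ᶠ n in atTop, e n + c n < Q n := by
    refine (hA'inf.and_eventually (hlim.eventually_ge_atTop 4)).mono fun n hn => ?_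
    have := hn.2
    simp only [hc, he, hn.1, if_false, hb]
    omega
  have hM : ∀ n ∉ A, Q n ≤ 8 * c n := fun n hn => by
    simp only [hc, hn, if_false, hb]
    omega
  have hmain := one_le_dimH_digits hQ hc1 hc2 hec hfreq 8
    (fun n hn => hM n fun hA => by simp [hc, hA] at hn)
    (fun r hr0 hr1 => exists_prod_rpow_le hQ hlim hc1 hM hent hr0 hr1)
  refine hmain.trans (dimH_mono ?_)
  rintro x ⟨-, hx⟩
  have hxA : ∀ n ∈ A, cantorDigit Q x n = ω n := fun n hn => by
    have := hx n
    simp only [hc, he, hn, if_true] at this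
    omega
  have hxA' : ∀ n ∉ A, b n ≤ cantorDigit Q x n ∧ cantorDigit Q x n < b n + b n := fun n hn => by
    have := hx n
    simpa only [hc, he, hn, if_false] using this
  have hbtop : Tendsto b atTop atTop := by
    refine tendsto_atTop_mono (fun n => le_max_right 1 (Q n / 4)) ?_
    exact (Nat.tendsto_div_const_atTop (by norm_num)).comp hlim
  refine ⟨Set.mem_iInter₂.2 fun k hk => mem_normalOfOrder_of_digits (hdiv k hk) (hbad k hk)
    (hω k hk) hbtop hxA fun n hn => (hxA' n hn).1, ?_⟩
  obtain ⟨N, hN⟩ := eventually_atTop.1 (hlim.eventually_ge_atTop 4)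
  -- A digit with `digit + 1 ≤ Q n / 2` puts the orbit point below `1 / 2`.
  refine notMem_distributionNormal_of_sparse (N := N) hdens fun n hn hnN => ?_
  have h1 := shiftMap_succ Q n x
  have h2 := shiftMap_lt_one Q (n + 1) x
  have h3 : 2 * (cantorDigit Q x n + 1) ≤ Q n := by
    have h5 := (hxA' n hn).2
    have h6 := hN n hnN
    simp only [hb] at h5
    omega
  have h3' : 2 * ((cantorDigit Q x n : ℝ) + 1) ≤ Q n := by exact_mod_cast h3
  have h4 : (2 : ℝ) ≤ Q n := by exact_mod_cast hQ n
  by_contra! hcon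
  nlinarith

/-! ### Stages and periods of the concatenation -/

/-- The nonvanishing clause is essential: where `b n = 0` the quotient is `0` by convention and says
nothing about `a n`. -/
theorem QuotientTendstoZero.eventually_le {a b : ℕ → ℝ} (h : QuotientTendstoZero a b)
    (hb : ∀ n, 0 ≤ b n) {ε : ℝ} (hε : 0 < ε) : ∀ᶠ n in atTop, a n ≤ ε * b n := by
  filter_upwards [h.1, h.2.eventually (gt_mem_nhds hε)] with n h1 h2
  have hbn : 0 < b n := lt_of_le_of_ne (hb n) h1.symm
  rw [div_lt_iff₀ hbn] at h2
  exact h2.le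

theorem stageStart_succ (s t υ : ℕ → ℕ) (i : ℕ) :
    stageStart s t υ (i + 1) = stageStart s t υ i + υ i * (s i + t i) := by
  simp [stageStart, Finset.sum_range_succ]

theorem stageStart_mono (s t υ : ℕ → ℕ) : Monotone (stageStart s t υ) :=
  monotone_nat_of_le_succ fun i => by rw [stageStart_succ]; omega

/-- If the word were finite, then past its end `stageOf` would be `sInf ∅ = 0`, and the sequence
would take only the values `α 0` and `β 0`. -/
theorem exists_lt_stageStart {α β s t υ : ℕ → ℕ} (hlim : InfiniteInLimit (blockSeq α β s t υ))
    (n : ℕ) : ∃ i, n < stageStart s t υ i := by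
  by_contra! hcon
  obtain ⟨m, hm1, hm2⟩ := ((hlim.eventually_gt_atTop (max (α 0) (β 0))).and
    (eventually_ge_atTop n)).exists
  have h0 : stageOf s t υ m = 0 := by
    rw [stageOf, Nat.sInf_eq_zero]
    right
    ext i
    simpa using (hcon (i + 1)).trans hm2
  simp only [blockSeq, h0] at hm1
  split_ifs at hm1 <;> omega

/-- The positions of `blockSeq α β s t υ` at which the terms come from `α`. -/
def leftPositions (s t υ : ℕ → ℕ) : Set ℕ :=
  {n | blockSeq (fun _ => 1) (fun _ => 0) s t υ n = 1}

/-- The first position of the `c`th repetition in stage `i`. -/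
def periodStart (s t υ : ℕ → ℕ) (i c : ℕ) : ℕ := stageStart s t υ i + c * (s i + t i)

section Periods

variable {s t υ : ℕ → ℕ} {i c : ℕ}

theorem mem_leftPositions (hc : c < υ i) {d : ℕ} (hd : d < s i + t i) :
    periodStart s t υ i c + d ∈ leftPositions s t υ ↔ d < s i := by
  rw [leftPositions, Set.mem_ofPred_eq, periodStart, blockSeq_apply _ _ s t υ hc hd]
  split_ifs with h <;> simp [h]

theorem le_of_period_le {F : ℕ → ℝ} {w : ℝ}
    (h : ∀ c < υ i, F (periodStart s t υ i c + (s i + t i)) ≤ F (periodStart s t υ i c) + w)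
    (hc : c ≤ υ i) : F (periodStart s t υ i c) ≤ F (stageStart s t υ i) + c * w := by
  induction c with
  | zero => simp [periodStart]
  | succ c ih =>
    have h1 := h c (by omega)
    have h2 := ih (by omega)
    have e : periodStart s t υ i (c + 1) = periodStart s t υ i c + (s i + t i) := by
      simp only [periodStart]; ring
    rw [e]
    push_cast
    linarith

/-- Summing increments over periods and stages; applied to `-F`, it gives lower bounds. -/
theorem le_sum_of_period_le {F w : ℕ → ℝ} (h : ∀ i, ∀ c < υ i,
      F (periodStart s t υ i c + (s i + t i)) ≤ F (periodStart s t υ i c) + w i) (i : ℕ) :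
    F (stageStart s t υ i) ≤ F 0 + ∑ j ∈ Finset.range i, υ j * w j := by
  induction i with
  | zero => simp [stageStart]
  | succ i ih =>
    have h1 := le_of_period_le (h i) le_rfl
    have e : periodStart s t υ i (υ i) = stageStart s t υ (i + 1) := (stageStart_succ s t υ i).symm
    rw [e] at h1
    rw [Finset.sum_range_succ]
    linarith

/-- A function that does not increase over the periods of late stages is bounded by its growth
inside of a single period. -/
theorem exists_stage_le {F e : ℕ → ℝ} {I : ℕ} (hinf : ∀ n, ∃ i, n < stageStart s t υ i)
    (hper : ∀ i ≥ I, ∀ c < υ i,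
      F (periodStart s t υ i c + (s i + t i)) ≤ F (periodStart s t υ i c))
    (hpart : ∀ i ≥ I, ∀ c < υ i, ∀ d ≤ s i + t i,
      F (periodStart s t υ i c + d) ≤ F (periodStart s t υ i c) + e i)
    {n : ℕ} (hn : stageStart s t υ I ≤ n) :
    ∃ i ≥ I, stageStart s t υ i ≤ n ∧ F n ≤ F (stageStart s t υ I) + e i := by
  classical
  have hstage : ∀ i ≥ I, F (stageStart s t υ i) ≤ F (stageStart s t υ I) := by
    intro i hi
    induction i, hi using Nat.le_induction with
    | base => exact le_rfl
    | succ i hi ih =>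
      have h1 := le_of_period_le (F := F) (w := 0) (fun c hc => by simpa using hper i hi c hc) le_rfl
      have e : periodStart s t υ i (υ i) = stageStart s t υ (i + 1) :=
        (stageStart_succ s t υ i).symm
      rw [e, mul_zero, add_zero] at h1
      exact h1.trans ih
  obtain ⟨j, hspec, hmin⟩ : ∃ j, n < stageStart s t υ j ∧ ∀ m < j, ¬ n < stageStart s t υ m :=
    ⟨_, Nat.find_spec (hinf n), fun m => Nat.find_min (hinf n)⟩
  have hjI : I < j := by
    by_contra! hcon
    have := stageStart_mono s t υ hcon
    omega
  obtain ⟨i, rfl⟩ : ∃ i, j = i + 1 := ⟨j - 1, by omega⟩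
  have hi : stageStart s t υ i ≤ n := by simpa using hmin i (by omega)
  have hlt := stageStart_succ s t υ i
  have hpos : 0 < s i + t i := by
    rcases Nat.eq_zero_or_pos (s i + t i) with h | h
    · rw [h] at hlt; omega
    · exact h
  -- Division with remainder locates `n` at offset `d` in the `c`th period of its stage.
  set d := (n - stageStart s t υ i) % (s i + t i)
  set c := (n - stageStart s t υ i) / (s i + t i) with hc
  have hcυ : c < υ i := by
    rw [hc, Nat.div_lt_iff_lt_mul hpos]
    omega
  have hd : d < s i + t i := Nat.mod_lt _ hpos
  have hncd : n = periodStart s t υ i c + d := by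
    have : (s i + t i) * c + d = n - stageStart s t υ i := Nat.div_add_mod _ _
    rw [periodStart, mul_comm c]
    omega
  refine ⟨i, by omega, hi, ?_⟩
  have h1 := hpart i (by omega) c hcυ d hd.le
  have h2 := le_of_period_le (F := F) (w := 0)
    (fun c hc => by simpa using hper i (by omega) c hc) hcυ.le
  rw [mul_zero, add_zero] at h2
  have h3 := hstage i (by omega)
  rw [← hncd] at h1
  linarith

theorem sum_range_ite_lt (u v : ℝ) (d m : ℕ) :
    ∑ x ∈ Finset.range d, (if x < m then u else v) = (min d m : ℕ) * u + (d - m : ℕ) * v := by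
  induction d with
  | zero => simp
  | succ d ih =>
    rw [Finset.sum_range_succ, ih]
    split_ifs with h
    · rw [min_eq_left h.le, min_eq_left (show d + 1 ≤ m by omega), Nat.sub_eq_zero_of_le h.le,
        Nat.sub_eq_zero_of_le (show d + 1 ≤ m by omega)]
      push_cast; ring
    · rw [min_eq_right (by omega), min_eq_right (by omega), Nat.succ_sub (by omega)]
      push_cast; ring

/-- The sum of a function that is constant on each of the two parts of a period. -/
theorem sum_period {f : ℕ → ℝ} {a m d : ℕ} {u v : ℝ}
    (h : ∀ x < d, f (a + x) = if x < m then u else v) :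
    ∑ p ∈ Finset.range (a + d), f p =
      ∑ p ∈ Finset.range a, f p + ((min d m : ℕ) * u + (d - m : ℕ) * v) := by
  rw [Finset.sum_range_add, ← sum_range_ite_lt]
  congr 1
  exact Finset.sum_congr rfl fun x hx => h x (Finset.mem_range.1 hx)

end Periods

/-! ### The sparse-set hypotheses for the concatenation -/

section Conditions

variable {α β s t υ : ℕ → ℕ}

theorem IsBasicSequence.blockSeq (hα : IsBasicSequence α) (hβ : IsBasicSequence β) :
    IsBasicSequence (blockSeq α β s t υ) := by
  intro n
  simp only [_root_.blockSeq]
  split_ifs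
  · exact hα _
  · exact hβ _

theorem blockSeq_periodStart {i c d : ℕ} (hc : c < υ i) (hd : d < s i + t i) :
    blockSeq α β s t υ (periodStart s t υ i c + d) = if d < s i then α i else β i :=
  blockSeq_apply α β s t υ hc hd

/-- At the end of a stage the relative frequency of left positions is bounded by the quotient in
DNQ. Times inside a stage are not controlled, which is why the conclusion is only frequent. -/
theorem frequently_sum_leftPositions_le (hlim : InfiniteInLimit (blockSeq α β s t υ))
    (hDNQ : CondDNQ s t υ) {ε : ℝ} (hε : 0 < ε) :
    ∃ᶠ n : ℕ in atTop,
      ∑ p ∈ Finset.range n, (leftPositions s t υ).indicator (fun _ => (1 : ℝ)) p ≤ ε * n := by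
  have hcount : ∀ i, ∑ p ∈ Finset.range (stageStart s t υ i),
      (leftPositions s t υ).indicator (fun _ => (1 : ℝ)) p ≤
        ∑ j ∈ Finset.range i, (υ j : ℝ) * s j := by
    intro i
    have := le_sum_of_period_le (s := s) (t := t) (υ := υ) (F := fun n => ∑ p ∈ Finset.range n,
      (leftPositions s t υ).indicator (fun _ => (1 : ℝ)) p) (w := fun j => s j) (fun i c hc => ?_) i
    · simpa using this
    · rw [sum_period (m := s i) (u := 1) (v := 0) fun x hx => ?_]
      · simp
      · by_cases h : x < s i
        · rw [Set.indicator_of_mem ((mem_leftPositions hc hx).2 h), if_pos h]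
        · rw [Set.indicator_of_notMem (mt (mem_leftPositions hc hx).1 h), if_neg h]
  have hev := hDNQ.eventually_le (fun n => Finset.sum_nonneg fun j _ => by positivity) hε
  rw [frequently_atTop]
  intro N
  obtain ⟨i, hi⟩ := exists_lt_stageStart hlim N
  obtain ⟨j, hj, hji⟩ := (hev.and (eventually_ge_atTop i)).exists
  refine ⟨stageStart s t υ (j + 1),
    hi.le.trans (stageStart_mono s t υ (hji.trans (Nat.le_succ j))), (hcount (j + 1)).trans ?_⟩
  refine hj.trans_eq ?_
  simp [stageStart]

/-- With `L` and `L'` the entropies on and off the left positions, HDT2 prevents `L - (ε / 2) * L'`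
from increasing over a late period. Inside a period it exceeds its initial value by at most `s i *
log (α i)`, which HDT1 bounds by `ε / 2` times the part of `L'` from earlier stages. -/
theorem exists_sum_log_le (hα : IsBasicSequence α) (hβ : IsBasicSequence β)
    (hlim : InfiniteInLimit (blockSeq α β s t υ))
    (hHDT1 : CondHDT1 α β s t υ) (hHDT2 : CondHDT2 α β s t) {ε : ℝ} (hε : 0 < ε) :
    ∃ C, ∀ n, ∑ p ∈ Finset.range n,
        (leftPositions s t υ).indicator (fun p => Real.log (blockSeq α β s t υ p)) p ≤
      ε * ∑ p ∈ Finset.range n,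
        (leftPositions s t υ)ᶜ.indicator (fun p => Real.log (blockSeq α β s t υ p)) p + C := by
  set Q := blockSeq α β s t υ with hQ
  set A := leftPositions s t υ with hA
  set L : ℕ → ℝ := fun n => ∑ p ∈ Finset.range n, A.indicator (fun p => Real.log (Q p)) p with hL
  set L' : ℕ → ℝ := fun n => ∑ p ∈ Finset.range n, Aᶜ.indicator (fun p => Real.log (Q p)) p with hL'
  have hlog : ∀ {q : ℕ}, 2 ≤ q → 0 ≤ Real.log q := fun {q} hq =>
    Real.log_nonneg (by exact_mod_cast (by omega : 1 ≤ q))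
  have hQlog : ∀ n, 0 ≤ Real.log (Q n) := fun n => hlog (hα.blockSeq hβ n)
  have hLmono : Monotone L := fun m n h =>
    Finset.sum_le_sum_of_subset_of_nonneg (Finset.range_mono h) fun _ _ _ =>
      Set.indicator_nonneg (fun _ _ => hQlog _) _
  have hL'mono : Monotone L' := fun m n h =>
    Finset.sum_le_sum_of_subset_of_nonneg (Finset.range_mono h) fun _ _ _ =>
      Set.indicator_nonneg (fun _ _ => hQlog _) _
  have hL'0 : ∀ n, 0 ≤ L' n := fun n =>
    Finset.sum_nonneg fun _ _ => Set.indicator_nonneg (fun _ _ => hQlog _) _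
  have hper : ∀ i, ∀ c < υ i, ∀ d ≤ s i + t i,
      L (periodStart s t υ i c + d) = L (periodStart s t υ i c) +
        ((min d (s i) : ℕ) * Real.log (α i) + (d - s i : ℕ) * 0) := fun i c hc d hd =>
    sum_period fun x hx => by
      have hx' : x < s i + t i := by omega
      by_cases h : x < s i
      · rw [Set.indicator_of_mem ((mem_leftPositions hc hx').2 h), hQ, blockSeq_periodStart hc hx',
          if_pos h, if_pos h]
      · rw [Set.indicator_of_notMem (mt (mem_leftPositions hc hx').1 h), if_neg h]
  have hper' : ∀ i, ∀ c < υ i, ∀ d ≤ s i + t i,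
      L' (periodStart s t υ i c + d) = L' (periodStart s t υ i c) +
        ((min d (s i) : ℕ) * 0 + (d - s i : ℕ) * Real.log (β i)) := fun i c hc d hd =>
    sum_period fun x hx => by
      have hx' : x < s i + t i := by omega
      by_cases h : x < s i
      · rw [Set.indicator_of_notMem (Set.notMem_compl_iff.2 ((mem_leftPositions hc hx').2 h)), if_pos h]
      · rw [Set.indicator_of_mem (Set.mem_compl (mt (mem_leftPositions hc hx').1 h)), if_neg h, hQ,
          blockSeq_periodStart hc hx', if_neg h]
  have hL'stage : ∀ i, ∑ j ∈ Finset.range i, (υ j : ℝ) * (t j : ℝ) * Real.log (β j) ≤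
      L' (stageStart s t υ i) := by
    intro i
    have := le_sum_of_period_le (F := fun n => -L' n) (w := fun i => -(t i * Real.log (β i)))
      (fun i c hc => by
        rw [hper' i c hc _ le_rfl, Nat.add_sub_cancel_left]
        simp) i
    simp only [mul_neg, Finset.sum_neg_distrib] at this
    have h0 : L' 0 = 0 := by simp [hL']
    simp only [h0, ← mul_assoc] at this
    linarith
  have hε2 : 0 < ε / 2 := by positivity
  obtain ⟨I, hI⟩ := eventually_atTop.1
    ((hHDT1.eventually_le (fun n => Finset.sum_nonneg fun j _ =>
      mul_nonneg (by positivity) (hlog (hβ j))) hε2).and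
    (hHDT2.eventually_le (fun n => mul_nonneg (by positivity) (hlog (hβ n))) hε2))
  refine ⟨|L (stageStart s t υ I) - ε / 2 * L' (stageStart s t υ I)| + |L (stageStart s t υ I)|,
    fun n => ?_⟩
  change L n ≤ ε * L' n + _
  have habs1 := abs_nonneg (L (stageStart s t υ I) - ε / 2 * L' (stageStart s t υ I))
  have habs2 := le_abs_self (L (stageStart s t υ I) - ε / 2 * L' (stageStart s t υ I))
  have habs3 := le_abs_self (L (stageStart s t υ I))
  rcases le_or_gt n (stageStart s t υ I) with hn | hn
  · have := hLmono hn
    have := mul_nonneg hε.le (hL'0 n)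
    linarith
  · obtain ⟨i, hiI, hin, hi⟩ := exists_stage_le (F := fun n => L n - ε / 2 * L' n)
      (e := fun i => s i * Real.log (α i)) (exists_lt_stageStart hlim)
      (fun i hi c hc => by
        rw [hper i c hc _ le_rfl, hper' i c hc _ le_rfl, Nat.add_sub_cancel_left,
          min_eq_right (by omega)]
        have := (hI i hi).2
        linarith)
      (fun i hi c hc d hd => by
        rw [hper i c hc d hd, hper' i c hc d hd]
        have h1 : ((min d (s i) : ℕ) : ℝ) * Real.log (α i) ≤ s i * Real.log (α i) :=
          mul_le_mul_of_nonneg_right (by exact_mod_cast min_le_right _ _) (hlog (hα i))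
        have h2 : 0 ≤ ε / 2 * (((d - s i : ℕ) : ℝ) * Real.log (β i)) :=
          mul_nonneg hε2.le (mul_nonneg (by positivity) (hlog (hβ i)))
        linarith) hn.le
    have h1 := (hI i hiI).1
    have h2 := mul_le_mul_of_nonneg_left ((hL'stage i).trans (hL'mono hin)) hε2.le
    have h3 := abs_nonneg (L (stageStart s t υ I))
    linarith

/-- The positions at distance less than `k` from the complement of `A`. -/
def nearCompl (A : Set ℕ) (k : ℕ) : Set ℕ := {m | ∃ m', m' < m + k ∧ m < m' + k ∧ m' ∉ A}

/-- The product is at least the `k`th power of its smallest factor. This replaces blocks with mixed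
bases by weights of single positions. -/
theorem one_div_prod_le_sum {Q : ℕ → ℕ} (hQ : IsBasicSequence Q) {k : ℕ} (hk : 1 ≤ k) (p : ℕ) :
    1 / ∏ l ∈ Finset.range k, (Q (p + l) : ℝ) ≤
      ∑ l ∈ Finset.range k, 1 / (Q (p + l) : ℝ) ^ k := by
  have hQ0 : ∀ n, (0 : ℝ) < Q n := fun n => by
    have := hQ n
    exact_mod_cast (by omega : 0 < Q n)
  obtain ⟨l, hl, hmin⟩ := Finset.exists_min_image (Finset.range k) (fun l => Q (p + l))
    ⟨0, Finset.mem_range.2 hk⟩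
  have h1 : (Q (p + l) : ℝ) ^ k ≤ ∏ l ∈ Finset.range k, (Q (p + l) : ℝ) := by
    calc (Q (p + l) : ℝ) ^ k = ∏ _l' ∈ Finset.range k, (Q (p + l) : ℝ) := by simp
      _ ≤ _ := Finset.prod_le_prod (fun _ _ => (hQ0 _).le) fun l' hl' => by
        exact_mod_cast hmin l' hl'
  calc 1 / ∏ l ∈ Finset.range k, (Q (p + l) : ℝ) ≤ 1 / (Q (p + l) : ℝ) ^ k :=
        one_div_le_one_div_of_le (pow_pos (hQ0 _) _) h1
    _ ≤ _ := Finset.single_le_sum (f := fun l => 1 / (Q (p + l) : ℝ) ^ k)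
        (fun l _ => by positivity) hl

/-- A block that leaves `A` consists of positions in `nearCompl A k`, and each position belongs to
at most `k` blocks. The extra `k` absorbs the shift of the summation window, as the weights are at
most `1`. -/
theorem blockMean_sub_restrictedMean_le {Q : ℕ → ℕ} (hQ : IsBasicSequence Q) (A : Set ℕ) {k : ℕ}
    (hk : 1 ≤ k) (n : ℕ) :
    blockMean Q k n - restrictedMean Q A k n ≤
      k * (∑ p ∈ Finset.range n, (nearCompl A k).indicator (fun m => 1 / (Q m : ℝ) ^ k) p + k) := by
  set w : ℕ → ℝ := (nearCompl A k).indicator (fun m => 1 / (Q m : ℝ) ^ k) with hw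
  have hw0 : ∀ m, 0 ≤ w m := fun m => Set.indicator_nonneg (fun _ _ => by positivity) _
  have hw1 : ∀ m, w m ≤ 1 := fun m => by
    refine (Set.indicator_le_self' (fun _ _ => by positivity) m).trans ?_
    have : (1 : ℝ) ≤ Q m := by have := hQ m; exact_mod_cast (by omega : 1 ≤ Q m)
    rw [div_le_one (by positivity)]
    exact one_le_pow₀ this
  have hterm : ∀ p, 1 / ∏ l ∈ Finset.range k, (Q (p + l) : ℝ) - (blockPositions A k).indicator
      (fun p => 1 / ∏ l ∈ Finset.range k, (Q (p + l) : ℝ)) p ≤ ∑ l ∈ Finset.range k, w (p + l) := by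
    intro p
    by_cases hp : p ∈ blockPositions A k
    · rw [Set.indicator_of_mem hp, sub_self]
      exact Finset.sum_nonneg fun l _ => hw0 _
    · rw [Set.indicator_of_notMem hp, sub_zero]
      refine (one_div_prod_le_sum hQ hk p).trans_eq (Finset.sum_congr rfl fun l hl => ?_)
      have hl' := Finset.mem_range.1 hl
      simp only [blockPositions, Set.mem_ofPred_eq, not_forall] at hp
      obtain ⟨l', hl'k, hp⟩ := hp
      have hmem : p + l ∈ nearCompl A k := ⟨p + l', by omega, by omega, hp⟩
      rw [hw, Set.indicator_of_mem hmem]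
  have hshift : ∀ l ∈ Finset.range k, ∑ p ∈ Finset.range n, w (p + l) ≤
      ∑ p ∈ Finset.range n, w p + k := by
    intro l hl
    have hl' : (l : ℝ) ≤ k := by exact_mod_cast (Finset.mem_range.1 hl).le
    have h1 : ∑ p ∈ Finset.range (l + n), w p =
        ∑ p ∈ Finset.range l, w p + ∑ p ∈ Finset.range n, w (p + l) := by
      rw [Finset.sum_range_add]
      simp only [add_comm]
    have h2 : ∑ p ∈ Finset.range (n + l), w p ≤ ∑ p ∈ Finset.range n, w p + l := by
      rw [Finset.sum_range_add]
      gcongr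
      refine (Finset.sum_le_sum fun x _ => hw1 _).trans_eq ?_
      simp
    rw [add_comm n l] at h2
    have h3 : 0 ≤ ∑ p ∈ Finset.range l, w p := Finset.sum_nonneg fun _ _ => hw0 _
    linarith
  rw [blockMean, restrictedMean, ← Finset.sum_sub_distrib]
  refine (Finset.sum_le_sum fun p _ => hterm p).trans ?_
  rw [Finset.sum_comm]
  refine (Finset.sum_le_sum hshift).trans_eq ?_
  rw [Finset.sum_const, Finset.card_range, nsmul_eq_mul]

/-- In a left run only the `k` positions at either end can be near the complement, while every other
position starts a block inside the run and contributes `1 / α ^ k` to the mean. The ends are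
negligible as `s → ∞`, and the right run, of weight at most `t / β ^ k`, is negligible by NQ. -/
theorem exists_sum_nearCompl_le (hα : IsBasicSequence α) (hβ : IsBasicSequence β)
    (hlim : InfiniteInLimit (blockSeq α β s t υ)) {k : ℕ} (hNQ : CondNQ α β s t k)
    (hs : Tendsto s atTop atTop) {ε : ℝ} (hε : 0 < ε) :
    ∃ C, ∀ n, ∑ p ∈ Finset.range n, (nearCompl (leftPositions s t υ) k).indicator
        (fun m => 1 / (blockSeq α β s t υ m : ℝ) ^ k) p ≤
      ε * restrictedMean (blockSeq α β s t υ) (leftPositions s t υ) k n + C := by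
  set Q := blockSeq α β s t υ with hQ
  set A := leftPositions s t υ with hA
  set w : ℕ → ℝ := (nearCompl A k).indicator (fun m => 1 / (Q m : ℝ) ^ k) with hw
  set g : ℕ → ℝ := (blockPositions A k).indicator
    (fun p => 1 / ∏ l ∈ Finset.range k, (Q (p + l) : ℝ)) with hg
  set F : ℕ → ℝ := fun n => ∑ p ∈ Finset.range n, (w p - ε * g p) with hF
  have hg0 : ∀ p, 0 ≤ g p := fun p => Set.indicator_nonneg (fun _ _ => by positivity) _
  have hw0 : ∀ p, 0 ≤ w p := fun p => Set.indicator_nonneg (fun _ _ => by positivity) _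
  -- Every position is credited with `-ε / α ^ k`; an end position is charged `(1 + ε) / α ^ k`,
  -- which cancels the credit and leaves its weight.
  have hleft : ∀ i, ∀ c < υ i, ∀ x < s i,
      w (periodStart s t υ i c + x) - ε * g (periodStart s t υ i c + x) ≤
        (1 + ε) / (α i : ℝ) ^ k * ((if x < k then 1 else 0) + (if x < s i - k then 0 else 1)) -
          ε / (α i : ℝ) ^ k := by
    intro i c hc x hx
    have ha : (0 : ℝ) < 1 / (α i : ℝ) ^ k := by
      have := hα i
      have : (0 : ℝ) < α i := by exact_mod_cast (by omega : 0 < α i)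
      positivity
    have hwle : w (periodStart s t υ i c + x) ≤ 1 / (α i : ℝ) ^ k := by
      refine (Set.indicator_le_self' (fun _ _ => by positivity) _).trans_eq ?_
      rw [hQ, blockSeq_periodStart hc (by omega), if_pos hx]
    rw [div_eq_mul_one_div (1 + ε), div_eq_mul_one_div ε]
    set z := 1 / (α i : ℝ) ^ k
    have hgx := mul_nonneg hε.le (hg0 (periodStart s t υ i c + x))
    have hεz := mul_pos hε ha
    by_cases h1 : x < k
    · rw [if_pos h1]
      split_ifs <;> nlinarith
    rw [if_neg h1]
    by_cases h2 : x < s i - k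
    · have hwz : w (periodStart s t υ i c + x) = 0 := by
        refine Set.indicator_of_notMem ?_ _
        rintro ⟨m', hm1, hm2, hm3⟩
        obtain ⟨x', rfl⟩ : ∃ x', m' = periodStart s t υ i c + x' :=
          ⟨m' - periodStart s t υ i c, by omega⟩
        exact hm3 ((mem_leftPositions hc (by omega)).2 (by omega))
      have hgz : g (periodStart s t υ i c + x) = z := by
        rw [hg, Set.indicator_of_mem]
        · rw [Finset.prod_congr rfl fun l hl => ?_, Finset.prod_const, Finset.card_range]
          have := Finset.mem_range.1 hl
          rw [hQ, add_assoc, blockSeq_periodStart hc (by omega), if_pos (by omega)]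
        · intro l hl
          rw [add_assoc]
          exact (mem_leftPositions hc (by omega)).2 (by omega)
      rw [if_pos h2, hwz, hgz]
      linarith
    · rw [if_neg h2]
      linarith
  have hpart : ∀ i, ∀ c < υ i, ∀ d ≤ s i, F (periodStart s t υ i c + d) ≤
      F (periodStart s t υ i c) + (2 * k * (1 + ε) - ε * d) / (α i : ℝ) ^ k := by
    intro i c hc d hd
    simp only [hF]
    rw [Finset.sum_range_add]
    gcongr
    refine (Finset.sum_le_sum fun x hx => hleft i c hc x
      (by have := Finset.mem_range.1 hx; omega)).trans ?_
    rw [Finset.sum_sub_distrib, ← Finset.mul_sum, Finset.sum_add_distrib, sum_range_ite_lt,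
      sum_range_ite_lt, Finset.sum_const, Finset.card_range, nsmul_eq_mul]
    have h1 : ((min d k : ℕ) : ℝ) ≤ k := by exact_mod_cast min_le_right _ _
    have h2 : ((d - (s i - k) : ℕ) : ℝ) ≤ k := by exact_mod_cast (by omega : d - (s i - k) ≤ k)
    have h3 : 0 ≤ (1 + ε) / (α i : ℝ) ^ k := by positivity
    calc _ ≤ (1 + ε) / (α i : ℝ) ^ k * (2 * k) - d * (ε / (α i : ℝ) ^ k) := by
          gcongr
          linarith
      _ = _ := by ring
  have hright : ∀ i, ∀ c < υ i, ∀ d ≤ t i, F (periodStart s t υ i c + s i + d) ≤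
      F (periodStart s t υ i c + s i) + d * (1 / (β i : ℝ) ^ k) := by
    intro i c hc d hd
    simp only [hF]
    rw [Finset.sum_range_add]
    gcongr
    refine (Finset.sum_le_card_nsmul _ _ (1 / (β i : ℝ) ^ k) fun x hx => ?_).trans_eq (by simp)
    have hx' := Finset.mem_range.1 hx
    have h1 := mul_nonneg hε.le (hg0 (periodStart s t υ i c + s i + x))
    have h2 : w (periodStart s t υ i c + s i + x) ≤ 1 / (β i : ℝ) ^ k := by
      refine (Set.indicator_le_self' (fun _ _ => by positivity) _).trans_eq ?_
      rw [hQ, add_assoc, blockSeq_periodStart hc (by omega), if_neg (by omega)]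
    linarith
  -- Half of the credit `ε * s / α ^ k` of a left run pays for the following right run, the other
  -- half for the `2k` end positions.
  obtain ⟨I, hI⟩ := eventually_atTop.1
    ((hNQ.eventually_le (fun n => by positivity) (half_pos hε)).and
      ((tendsto_natCast_atTop_atTop.comp hs).eventually_ge_atTop (2 * k * (1 + ε) / (ε / 2))))
  have hlong : ∀ i ≥ I, ∀ c < υ i, ∀ d ≤ t i,
      F (periodStart s t υ i c + s i + d) ≤ F (periodStart s t υ i c) := by
    intro i hi c hc d hd
    have h1 := hpart i c hc (s i) le_rfl
    have h2 := hright i c hc d hd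
    have h3 := (hI i hi).1
    have h4 := (hI i hi).2
    simp only [Function.comp] at h4
    rw [div_le_iff₀ (half_pos hε)] at h4
    have ha : (0 : ℝ) < (α i : ℝ) ^ k := by
      have := hα i
      have : (0 : ℝ) < α i := by exact_mod_cast (by omega : 0 < α i)
      positivity
    have hb : (0 : ℝ) < (β i : ℝ) ^ k := by
      have := hβ i
      have : (0 : ℝ) < β i := by exact_mod_cast (by omega : 0 < β i)
      positivity
    have h5 : (2 * k * (1 + ε) - ε * s i) / (α i : ℝ) ^ k ≤ (-(ε / 2 * s i)) / (α i : ℝ) ^ k := by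
      gcongr
      linarith
    have h6 : (d : ℝ) * (1 / (β i : ℝ) ^ k) ≤ (ε / 2 * s i) / (α i : ℝ) ^ k := by
      have hd' : (d : ℝ) ≤ t i := by exact_mod_cast hd
      rw [mul_one_div, div_le_div_iff₀ hb ha]
      calc (d : ℝ) * (α i : ℝ) ^ k ≤ t i * (α i : ℝ) ^ k := by gcongr
        _ ≤ _ := by linarith
    rw [neg_div] at h5
    linarith
  have hmono : Monotone fun n => ∑ p ∈ Finset.range n, w p := fun m n h =>
    Finset.sum_le_sum_of_subset_of_nonneg (Finset.range_mono h) fun _ _ _ => hw0 _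
  have hR0 : ∀ n, 0 ≤ restrictedMean Q A k n := fun n => Finset.sum_nonneg fun p _ => hg0 p
  have hFe : ∀ n, F n = ∑ p ∈ Finset.range n, w p - ε * restrictedMean Q A k n := fun n => by
    simp only [hF, restrictedMean, Finset.sum_sub_distrib, Finset.mul_sum, hg]
  refine ⟨|F (stageStart s t υ I)| + 2 * k * (1 + ε) +
    ∑ p ∈ Finset.range (stageStart s t υ I), w p, fun n => ?_⟩
  have hW0 : 0 ≤ ∑ p ∈ Finset.range (stageStart s t υ I), w p := Finset.sum_nonneg fun _ _ => hw0 _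
  have hk0 : 0 ≤ 2 * (k : ℝ) * (1 + ε) := by positivity
  have habs := le_abs_self (F (stageStart s t υ I))
  rcases le_or_gt n (stageStart s t υ I) with hn | hn
  · have h1 : ∑ p ∈ Finset.range n, w p ≤ _ := hmono hn
    have h2 := mul_nonneg hε.le (hR0 n)
    have h3 := abs_nonneg (F (stageStart s t υ I))
    linarith
  · obtain ⟨i, -, -, hi⟩ := exists_stage_le (F := F) (e := fun _ => 2 * k * (1 + ε))
      (exists_lt_stageStart hlim)
      (fun i hi c hc => by
        rw [← add_assoc]
        exact hlong i hi c hc _ le_rfl)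
      (fun i hi c hc d hd => by
        rcases le_or_gt d (s i) with h | h
        · refine (hpart i c hc d h).trans ?_
          gcongr
          have h1 : (1 : ℝ) ≤ (α i : ℝ) ^ k :=
            one_le_pow₀ (by have := hα i; exact_mod_cast (by omega : 1 ≤ α i))
          rw [div_le_iff₀ (by linarith)]
          have h2 : 0 ≤ ε * d := by positivity
          nlinarith
        · have h1 := hlong i hi c hc (d - s i) (by omega)
          rw [add_assoc, Nat.add_sub_cancel' h.le] at h1
          linarith) hn.le
    rw [hFe n] at hi
    linarith

/-- Since `1 ≤ α ^ k`, the quotient can tend to `0` only if `s` is unbounded along every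
subsequence. RNQ enters the proof only through this. -/
theorem tendsto_atTop_of_condRNQ (hα : IsBasicSequence α) {k : ℕ} (h : CondRNQ α s k) :
    Tendsto s atTop atTop := by
  rw [← tendsto_natCast_atTop_iff (R := ℝ), tendsto_atTop]
  intro b
  filter_upwards [h.eventually_le (fun n => by positivity)
    (show (0 : ℝ) < 1 / max b 1 by positivity)] with n hn
  have h1 : (1 : ℝ) ≤ (α n : ℝ) ^ k :=
    one_le_pow₀ (by have := hα n; exact_mod_cast (by omega : 1 ≤ α n))
  have h2 := h1.trans hn
  rw [one_div_mul_eq_div, le_div_iff₀ (by positivity), one_mul] at h2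
  exact (le_max_left _ _).trans h2

theorem KDivergent.of_le {Q : ℕ → ℕ} (hQ : IsBasicSequence Q) {j k : ℕ} (hjk : j ≤ k)
    (h : KDivergent Q k) : KDivergent Q j := by
  refine tendsto_atTop_mono (fun n => Finset.sum_le_sum fun p _ => ?_) h
  have hQ1 : ∀ n, 1 ≤ Q n := fun n => by have := hQ n; omega
  refine one_div_le_one_div_of_le (Finset.prod_pos fun l _ => by exact_mod_cast hQ1 _) ?_
  have : ∏ l ∈ Finset.range j, Q (p + l) ≤ ∏ l ∈ Finset.range k, Q (p + l) :=
    Finset.prod_le_prod_of_subset_of_one_le' (Finset.range_mono hjk) fun _ _ _ => hQ1 _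
  exact_mod_cast this

/-- The set `J` of orders allows both assertions of the theorem to be treated at once: `J` is
`Set.Icc 1 k` or `Set.Ici 1`. -/
theorem dimH_normal_diff_distributionNormal_blockSeq (hα : IsBasicSequence α)
    (hβ : IsBasicSequence β) (hlim : InfiniteInLimit (blockSeq α β s t υ))
    (hHDT1 : CondHDT1 α β s t υ) (hHDT2 : CondHDT2 α β s t)
    (hNQ : ∀ j, 1 ≤ j → CondNQ α β s t j) (hs : Tendsto s atTop atTop) (hDNQ : CondDNQ s t υ)
    {J : Set ℕ} (hJ : ∀ j ∈ J, 1 ≤ j) (hdiv : ∀ j ∈ J, KDivergent (blockSeq α β s t υ) j) :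
    dimH ((⋂ j ∈ J, normalOfOrder (blockSeq α β s t υ) j) \
      distributionNormal (blockSeq α β s t υ)) = 1 := by
  refine dimH_normal_diff_distributionNormal (A := leftPositions s t υ) (hα.blockSeq hβ) hlim
    (fun ε hε => frequently_sum_leftPositions_le hlim hDNQ hε)
    (fun ε hε => exists_sum_log_le hα hβ hlim hHDT1 hHDT2 hε) (fun j hj ε hε => ?_) hdiv
  have hj0 : (0 : ℝ) < j := by exact_mod_cast hJ j hj
  -- The parameter `ε / j` compensates the factor `j` in `blockMean_sub_restrictedMean_le`.
  obtain ⟨C, hC⟩ := exists_sum_nearCompl_le hα hβ hlim (hNQ j (hJ j hj)) hs (div_pos hε hj0)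
  refine ⟨j * (C + j), fun n => (blockMean_sub_restrictedMean_le (hα.blockSeq hβ) _ (hJ j hj)
    n).trans ?_⟩
  calc _ ≤ (j : ℝ) * (ε / j * blockMean (blockSeq α β s t υ) j n + C + j) := by
        gcongr
        refine (hC n).trans ?_
        gcongr
        exact restrictedMean_le_blockMean _ _ _ _
    _ = _ := by field_simp; ring

end Conditions

theorem mainTheorem4 (α β s t υ : ℕ → ℕ) (k : ℕ) (hk : 1 ≤ k)
    (hα : IsBasicSequence α) (hβ : IsBasicSequence β)
    (hlim : InfiniteInLimit (blockSeq α β s t υ))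
    (hHDT1 : CondHDT1 α β s t υ) (hHDT2 : CondHDT2 α β s t)
    (hNQ : ∀ j, 1 ≤ j → CondNQ α β s t j)
    (hRNQ : CondRNQ α s k) (hDNQ : CondDNQ s t υ)
    (ho : (fun i => (α i : ℝ)) =o[atTop] (fun i => (β i : ℝ))) :
    (KDivergent (blockSeq α β s t υ) k →
      dimH ((⋂ j ∈ Set.Icc 1 k, normalOfOrder (blockSeq α β s t υ) j) \
        distributionNormal (blockSeq α β s t υ)) = 1) ∧
    (FullyDivergent (blockSeq α β s t υ) →
      dimH (normalNumbers (blockSeq α β s t υ) \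
        distributionNormal (blockSeq α β s t υ)) = 1) := by
  have hs := tendsto_atTop_of_condRNQ hα hRNQ
  exact ⟨fun h => dimH_normal_diff_distributionNormal_blockSeq hα hβ hlim hHDT1 hHDT2 hNQ hs hDNQ
      (fun _ hj => hj.1) fun _ hj => h.of_le (hα.blockSeq hβ) hj.2,
    fun h => dimH_normal_diff_distributionNormal_blockSeq hα hβ hlim hHDT1 hHDT2 hNQ hs hDNQ
      (fun _ hj => hj) h⟩
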